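/- **Conventions.** In a regular category, *projective* means projective with respect to regular epimorphisms, and *enough projectives* means that every object is a regular quotient of a projective one. A morphism is *proper* if it is a regular epimorphism followed by a normal monomorphism (a kernel). A *homological* category is a pointed, regular, protomodular category; a *semi-abelian* category is a pointed, Barr exact, protomodular category with binary coproducts. *Condition (P)*: if $k$ is a kernel of a split epimorphism $f\colon X\to Y$ and $X$ is projective, then the domain of $k$ is projective. A functor is *protoadditive* if it preserves kernels of split epimorphisms. A pair $A\xrightarrow{f}B\xrightarrow{g}D$ is *exact* if $gf=0$ and the induced morphism $A\to \operatorname{Ker}(g)$ is a regular epimorphism. Chain complexes are concentrated in degrees $n\ge 0$ (so $d_0=0$), and $H_n(C)=\operatorname{Coker}(C_{n+1}\to\operatorname{Ker}(d_n))$. The *Moore complex* $N(A)$ of a simplicial object $A$ has $N_0(A)=A_0$ and $N_n(A)=\bigcap_{0\le l\le n-1}\operatorname{Ker}(\partial_l\colon A_n\to A_{n-1})$ for $n\geq 1$, with differential $d_n$ the restriction of $\partial_n$. A *(projective) chain resolution* of $X$ is a chain complex $C(X)$ of projective objects with an augmentation $C(X)_0\to X$ such that $\cdots\to C(X)_1\to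 C(X)_0\to X\to 0$ is exact, the augmentation being a regular epimorphism. A *(projective) simplicial resolution* of $X$ is an augmented simplicial object $S(X)$, with $S_{-1}=X$ and $S_n$ projective for $n\ge0$, such that $\cdots\to N_1(S(X))\to N_0(S(X))\to X\to 0$ is exact, the augmentation being a regular epimorphism. A morphism $\varphi\colon C(X)\to C(Y)$ of complexes *lifts* $x\colon X\to Y$ if it commutes with $x$ and the augmentations. **Theorem.** Let $\mathcal C$ be a homological category with binary coproducts and enough projectives that satisfies Condition (P), let $\mathcal E$ be a semi-abelian category, and let $F\colon\mathcal C\to\mathcal E$ be a protoadditive functor that preserves binary coproducts and proper morphisms. (1) Let $X$ be an object of $\mathcal C$, let $S(X)$ be a simplicial resolution and $C(X)$ a chain resolution of $X$. Then the differentials of the complexes $N(F(S(X)))$, $F(N(S(X)))$ and $F(C(X))$ are proper morphisms, and for all $n\ge 0$ $$H_n(N(F(S(X))))\cong H_n(F(N(S(X))))\cong H_n(F(C(X))),$$ where the first isomorphism is induced by the canonical comparison $F(N(S(X)))\to N(F(S(X)))$; morphisms $N(S(X))\to C(X)$ lifting $1_X$ exist, and the second isomorphism is the one induced by any of them. (2)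 Suppose moreover that $\mathcal C$ is (equivalent to) a one-sorted finitary variety of algebras, and let $\mathbb G$ be the comonad on $\mathcal C$ induced by the forgetful adjunction to $\mathsf{Set}$. Let $\mathbb G(X)$ be the simplicial object with $\mathbb G(X)_n=\mathbb G^{n+1}X$, $\partial_i=\mathbb G^i\varepsilon\,\mathbb G^{n-i}$ and $\sigma_i=\mathbb G^i\delta\,\mathbb G^{n-i}$, and put $H_{n+1}(X,F)_{\mathbb G}=H_n(N(F(\mathbb G(X))))$. Choose a chain resolution $C(X)$ for every object $X$. Then for every $n\ge0$ the derived functor $L_n(F)\colon\mathcal C\to\mathcal E$, given by $L_n(F)(X)=H_n(F(C(X)))$ on objects and by $L_n(F)(x)=H_n(F(\varphi))$ for any lifting $\varphi\colon C(X)\to C(Y)$ of $x\colon X\to Y$, is well defined, and it is naturally isomorphic to $H_{n+1}(-,F)_{\mathbb G}$. -/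

import Mathlib

open CategoryTheory CategoryTheory.Limits Opposite ZeroObject

universe w v₁ v₂ u₁ u₂

noncomputable section

namespace NonAdditive

section Categories

variable {C : Type u₁} [Category.{v₁} C]

/-- `k` is a kernel of `f`. -/
def IsKernelOf [HasZeroMorphisms C] {K X Y : C} (k : K ⟶ X) (f : X ⟶ Y) : Prop :=
  ∃ w : k ≫ f = 0, Nonempty (IsLimit (KernelFork.ofι k w))

/-- A (Borceux--Bourn) homological category: pointed, regular and (Bourn) protomodular.
Protomodularity is stated as: for a split epimorphism `f` with section `s` and kernel `k`, the
morphisms `k` and `s` are jointly extremally epimorphic, that is, they do not both factor through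
a proper subobject. -/
class IsHomological (C : Type u₁) [Category.{v₁} C] [HasZeroMorphisms C] : Prop
    extends HasZeroObject C, Regular C where
  protomodular : ∀ {K X Y M : C} (k : K ⟶ X) (f : X ⟶ Y) (s : Y ⟶ X) (m : M ⟶ X)
    (k' : K ⟶ M) (s' : Y ⟶ M), s ≫ f = 𝟙 Y → IsKernelOf k f → Mono m →
    k' ≫ m = k → s' ≫ m = s → IsIso m

/-- A (Janelidze--Márki--Tholen) semi-abelian category: pointed, Barr exact (regular, with every
internal equivalence relation a kernel pair), Bourn protomodular, with binary coproducts. -/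
class IsSemiAbelian (C : Type u₁) [Category.{v₁} C] [HasZeroMorphisms C] : Prop
    extends IsHomological C where
  exact : ∀ {R X : C} (p₁ p₂ : R ⟶ X), IsEquivalenceRelation p₁ p₂ →
    ∃ (Q : C) (q : X ⟶ Q), IsKernelPair q p₁ p₂
  hasBinaryCoproducts : HasBinaryCoproducts C

attribute [instance] IsSemiAbelian.hasBinaryCoproducts

/-- A (regular) projective object: projective with respect to regular epimorphisms. -/
def IsRegularProjective (P : C) : Prop :=
  ∀ {X Y : C} (p : X ⟶ Y) (f : P ⟶ Y), IsRegularEpi p → ∃ g : P ⟶ X, g ≫ p = f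

/-- Every object is a regular quotient of a projective object. -/
def EnoughRegularProjectives (C : Type u₁) [Category.{v₁} C] : Prop :=
  ∀ A : C, ∃ (P : C) (p : P ⟶ A), IsRegularProjective P ∧ IsRegularEpi p

/-- Condition (P): the class of projectives is closed under protosplit subobjects, that is, under
kernels of split epimorphisms. -/
def ConditionP (C : Type u₁) [Category.{v₁} C] [HasZeroMorphisms C] : Prop :=
  ∀ {K X Y : C} (k : K ⟶ X) (f : X ⟶ Y), IsSplitEpi f → IsKernelOf k f →
    IsRegularProjective X → IsRegularProjective K

/-- A proper morphism: a regular epimorphism followed by a normal monomorphism. -/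
def IsProper [HasZeroMorphisms C] {X Y : C} (f : X ⟶ Y) : Prop :=
  ∃ (I : C) (e : X ⟶ I) (m : I ⟶ Y), IsRegularEpi e ∧ Nonempty (NormalMono m) ∧ e ≫ m = f

variable {E : Type u₂} [Category.{v₂} E] [HasZeroMorphisms C] [HasZeroMorphisms E]

/-- A protoadditive functor: it preserves kernels of split epimorphisms. -/
class IsProtoadditive (F : C ⥤ E) : Prop where
  map_kernel : ∀ {K X Y : C} (k : K ⟶ X) (f : X ⟶ Y), IsSplitEpi f → IsKernelOf k f →
    IsKernelOf (F.map k) (F.map f)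

/-- The functor `F` preserves proper morphisms. -/
def PreservesProper (F : C ⥤ E) : Prop :=
  ∀ {X Y : C} (f : X ⟶ Y), IsProper f → IsProper (F.map f)

/-- A protoadditive functor on a pointed category preserves zero morphisms, so that it acts on
chain complexes. -/
instance preservesZeroMorphisms_of_isProtoadditive [HasZeroObject C] (F : C ⥤ E)
    [IsProtoadditive F] : F.PreservesZeroMorphisms := by
  have h0 : ∀ X : C, F.map (0 : (0 : C) ⟶ X) = 0 := fun X => by
    have hk : IsKernelOf (0 : (0 : C) ⟶ X) (𝟙 X) :=
      ⟨by simp, ⟨KernelFork.IsLimit.ofι _ _ (fun _ _ => 0)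
        (fun g hg => by simpa using hg.symm) (fun _ _ _ _ => (isZero_zero C).eq_of_tgt _ _)⟩⟩
    obtain ⟨w, -⟩ := IsProtoadditive.map_kernel (F := F) _ _ inferInstance hk
    simpa using w
  refine ⟨fun X Y => ?_⟩
  have : (0 : X ⟶ Y) = (0 : X ⟶ (0 : C)) ≫ (0 : (0 : C) ⟶ Y) := by simp
  rw [this, F.map_comp, h0, comp_zero]

end Categories

section Cokernels

attribute [local simp] prod.lift_fst prod.lift_snd pullback.lift_fst pullback.lift_snd
  prod.lift_fst_assoc prod.lift_snd_assoc pullback.lift_fst_assoc pullback.lift_snd_assoc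
  coprod.inl_desc coprod.inr_desc coprod.inl_desc_assoc coprod.inr_desc_assoc

variable {C : Type u₁} [Category.{v₁} C] [HasZeroMorphisms C]

/-- In a homological category, two morphisms into a pullback of a split epimorphism, of the form
`a = ⟨1, _⟩` and `d = ⟨g ≫ r, 1⟩`, are jointly extremally epimorphic. -/
lemma isIso_of_pullback_sections [IsHomological C] {A B D M P : C} {f : A ⟶ B} {g : D ⟶ B}
    {p : P ⟶ A} {q : P ⟶ D} (h : IsPullback p q f g) (r : B ⟶ A)
    (m : M ⟶ P) [Mono m] (a : A ⟶ M) (d : D ⟶ M)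
    (ha₁ : a ≫ m ≫ p = 𝟙 A)
    (hd₁ : d ≫ m ≫ p = g ≫ r) (hd₂ : d ≫ m ≫ q = 𝟙 D) : IsIso m := by
  have hk : IsKernelOf (kernel.ι g ≫ d ≫ m) p := by
    refine ⟨by simp [hd₁], ⟨KernelFork.IsLimit.ofι _ _
      (fun {W} t ht => kernel.lift g (t ≫ q) (by rw [Category.assoc, ← h.w, ← Category.assoc, ht,
        zero_comp])) (fun {W} t ht => ?_) (fun {W} t ht b hb => ?_)⟩⟩
    · apply h.hom_ext
      · simp only [Category.assoc, hd₁, kernel.lift_ι_assoc, ht]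
        rw [← reassoc_of% h.w, reassoc_of% ht, zero_comp]
      · simp [hd₂]
    · rw [← cancel_mono (kernel.ι g), kernel.lift_ι, ← hb]
      simp [hd₂]
  exact IsHomological.protomodular (kernel.ι g ≫ d ≫ m) p (a ≫ m) m (kernel.ι g ≫ d) a
    (by simpa using ha₁) hk inferInstance (by simp) rfl

/-- In a homological category, every reflexive relation is an equivalence relation. -/
lemma isEquivalenceRelation_of_reflexive [IsHomological C] {R X : C} (d c : R ⟶ X)
    [hj : JointlyMono₂ d c] (i : X ⟶ R) (hd : i ≫ d = 𝟙 X) (hc : i ≫ c = 𝟙 X) :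
    IsEquivalenceRelation d c := by
  have hm : Mono (prod.lift d c) := ⟨fun a b h => hj.right_cancellation _ _
    (by simpa using congr($h ≫ prod.fst)) (by simpa using congr($h ≫ prod.snd))⟩
  let f := pullback.snd c c
  let g := pullback.fst d d
  let p := pullback.fst f g
  let q := pullback.snd f g
  let t := prod.lift (p ≫ pullback.fst c c ≫ d) (q ≫ pullback.snd d d ≫ c)
  have key : ∀ {W : C} (a b e : W ⟶ R), a ≫ c = b ≫ c → b ≫ d = e ≫ d →
      ∃ z : W ⟶ R, z ≫ d = a ≫ d ∧ z ≫ c = e ≫ c := by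
    let r := pullback.lift (f := c) (g := c) (𝟙 R) (𝟙 R) rfl
    let s := pullback.lift (f := d) (g := d) (𝟙 R) (𝟙 R) rfl
    have hr : r ≫ f = 𝟙 R := by simp [r, f]
    have hs : s ≫ g = 𝟙 R := by simp [s, g]
    let a₀ : pullback c c ⟶ pullback f g := pullback.lift (𝟙 _) (f ≫ s) (by simp [hs])
    let d₀ : pullback d d ⟶ pullback f g := pullback.lift (g ≫ r) (𝟙 _) (by simp [hr])
    have hfc : pullback.fst c c ≫ c = f ≫ c := pullback.condition
    have hgd : g ≫ d = pullback.snd d d ≫ d := pullback.condition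
    let m := pullback.fst t (prod.lift d c)
    let a₁ : pullback c c ⟶ pullback t (prod.lift d c) :=
      pullback.lift a₀ (pullback.fst c c) (by ext <;> simp [a₀, t, p, q, s, hfc])
    let d₁ : pullback d d ⟶ pullback t (prod.lift d c) :=
      pullback.lift d₀ (pullback.snd d d) (by ext <;> simp [d₀, t, p, q, r, hgd])
    have : IsIso m := isIso_of_pullback_sections (p := p) (q := q)
      (IsPullback.of_hasPullback f g) r m
      a₁ d₁ (by simp [a₁, m, a₀, p]) (by simp [d₁, m, d₀, p])
      (by simp [d₁, m, d₀, q])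
    intro W a b e hab hbe
    let z : W ⟶ pullback f g := pullback.lift (pullback.lift a b hab) (pullback.lift b e hbe)
      (by simp [f, g])
    have hz : (z ≫ inv m ≫ pullback.snd t (prod.lift d c)) ≫ prod.lift d c = z ≫ t := by
      rw [Category.assoc, Category.assoc, ← pullback.condition, IsIso.inv_hom_id_assoc]
    refine ⟨z ≫ inv m ≫ pullback.snd t (prod.lift d c), ?_, ?_⟩
    · simpa [t, z, p] using congr($hz ≫ prod.fst)
    · simpa [t, z, q] using congr($hz ≫ prod.snd)
  obtain ⟨σ, hσ₁, hσ₂⟩ := key (c ≫ i) (𝟙 R) (d ≫ i) (by simp [hc]) (by simp [hd])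
  obtain ⟨τ, hτ₁, hτ₂⟩ := key (pullback.fst c d) (pullback.fst c d ≫ c ≫ i)
    (pullback.snd c d) (by simp [hc]) (by simp [hd, pullback.condition])
  exact ⟨⟨{ right_cancellation := hj.right_cancellation
            r := i
            reflexivity₁ := hd
            reflexivity₂ := hc
            s := σ
            symmetry₁ := by simpa [hd] using hσ₁
            symmetry₂ := by simpa [hc] using hσ₂
            c := pullback.cone c d
            isLimit := pullback.isLimit c d
            t := τ
            transitivity₁ := hτ₁
            transitivity₂ := hτ₂ }⟩⟩

/-- Semi-abelian categories have cokernels, so that homology objects exist. -/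
instance hasCokernels_of_isSemiAbelian [IsSemiAbelian C] : HasCokernels C where
  has_colimit {A B} f := by
    let u : A ⨿ B ⟶ B := coprod.desc f (𝟙 B)
    let v : A ⨿ B ⟶ B := coprod.desc 0 (𝟙 B)
    let fac := Regular.strongEpiMonoFactorisation (prod.lift u v)
    let d : fac.I ⟶ B := fac.m ≫ prod.fst
    let c : fac.I ⟶ B := fac.m ≫ prod.snd
    have hu : fac.e ≫ d = u := by simp [d]
    have hv : fac.e ≫ c = v := by simp [c]
    have hj : JointlyMono₂ d c := ⟨fun Y a b h₁ h₂ => by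
      rw [← cancel_mono fac.m]
      ext
      · simpa [d] using h₁
      · simpa [c] using h₂⟩
    have he := isEquivalenceRelation_of_reflexive d c (coprod.inr ≫ fac.e)
      (by rw [Category.assoc, hu]; simp [u]) (by rw [Category.assoc, hv]; simp [v])
    obtain ⟨Q, q, hq⟩ := IsSemiAbelian.exact d c he
    have := Regular.hasCoequalizer_of_isKernelPair hq
    have hπ : u ≫ coequalizer.π d c = v ≫ coequalizer.π d c := by
      calc u ≫ coequalizer.π d c = fac.e ≫ d ≫ coequalizer.π d c := by rw [reassoc_of% hu]
        _ = v ≫ coequalizer.π d c := by rw [coequalizer.condition, reassoc_of% hv]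
    have w : f ≫ coequalizer.π d c = 0 := by
      simpa [u, v] using congr(coprod.inl ≫ $hπ)
    refine HasColimit.mk ⟨CokernelCofork.ofπ (coequalizer.π d c) w, CokernelCofork.IsColimit.ofπ
      _ _ (fun {W} t ht => coequalizer.desc t ?_) (fun {W} t ht => by simp)
      (fun {W} t ht b hb => ?_)⟩
    · rw [← cancel_epi fac.e, reassoc_of% hu, reassoc_of% hv]
      ext <;> simp [u, v, ht]
    · rw [← cancel_epi (coequalizer.π d c), hb]
      simp

end Cokernels

section Homology

variable {C : Type u₁} [Category.{v₁} C] [HasZeroMorphisms C]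

/-- `A ⟶ B ⟶ D` is exact at `B`: the composite is zero and the lifting of `f` over the kernel
of `g` is a regular epimorphism. -/
def IsExactPair [HasKernels C] {A B D : C} (f : A ⟶ B) (g : B ⟶ D) : Prop :=
  ∃ w : f ≫ g = 0, IsRegularEpi (kernel.lift g f w)

/-- A proper chain complex: all differentials are proper morphisms. -/
def IsProperComplex (K : ChainComplex C ℕ) : Prop :=
  ∀ n : ℕ, IsProper (K.d (n + 1) n)

/-- The `n`-th homology functor: `H_n(K)` is the cokernel of the lifting `K_{n+1} ⟶ Ker (d_n)` of
`d_{n+1}` over the kernel of `d_n` (where `d_0 = 0`). -/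
def homologyFunctor (C : Type u₁) [Category.{v₁} C] [HasZeroMorphisms C] [HasKernels C]
    [HasCokernels C] (n : ℕ) : ChainComplex C ℕ ⥤ C :=
  HomologicalComplex.shortComplexFunctor C (ComplexShape.down ℕ) n ⋙
    ShortComplex.leftHomologyFunctor C

/-- The action of a zero-preserving functor on chain complexes. -/
abbrev mapComplex {E : Type u₂} [Category.{v₂} E] [HasZeroMorphisms E] (F : C ⥤ E)
    [F.PreservesZeroMorphisms] : ChainComplex C ℕ ⥤ ChainComplex E ℕ :=
  F.mapHomologicalComplex (ComplexShape.down ℕ)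

/-- The action of a functor on simplicial objects. -/
abbrev mapSimplicial {E : Type u₂} [Category.{v₂} E] (F : C ⥤ E) :
    SimplicialObject C ⥤ SimplicialObject E :=
  (SimplicialObject.whiskering C E).obj F

/-- The object `A_n` of a simplicial object `A`. -/
abbrev level (A : SimplicialObject C) (n : ℕ) : C := A.obj (op (SimplexCategory.mk n))

end Homology

section Moore

variable {C : Type u₁} [Category.{v₁} C] [HasZeroMorphisms C] [HasFiniteLimits C]

namespace Moore

variable (A : SimplicialObject C)

/-- `N_0(A) = A_0` and `N_{n+1}(A)` is the kernel of `(∂_l)_{0 ≤ l ≤ n} : A_{n+1} ⟶ A_n^{n+1}`. -/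
def obj : ℕ → C
  | 0 => level A 0
  | n + 1 => kernel (Pi.lift (fun l : Fin (n + 1) => A.δ l.castSucc))

/-- The canonical inclusion `N_n(A) ⟶ A_n`. -/
def ι : ∀ n : ℕ, obj A n ⟶ level A n
  | 0 => 𝟙 (level A 0)
  | n + 1 => kernel.ι (Pi.lift (fun l : Fin (n + 1) => A.δ l.castSucc))

lemma ι_δ (n : ℕ) (l : Fin (n + 1)) : ι A (n + 1) ≫ A.δ l.castSucc = 0 := by
  have h : ι A (n + 1) ≫ Pi.lift (fun l : Fin (n + 1) => A.δ l.castSucc) = 0 :=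
    kernel.condition _
  have h' := congr($h ≫ Pi.π _ l)
  rwa [zero_comp, Category.assoc, Pi.lift_π] at h'

instance (n : ℕ) : Mono (ι A n) := by
  cases n
  · exact inferInstanceAs (Mono (𝟙 _))
  · exact inferInstanceAs (Mono (kernel.ι _))

/-- The universal property of `N_{n+1}(A)`. -/
def lift {n : ℕ} {W : C} (g : W ⟶ level A (n + 1)) (hg : ∀ l : Fin (n + 1), g ≫ A.δ l.castSucc = 0) :
    W ⟶ obj A (n + 1) :=
  kernel.lift _ g (by
    apply Limits.Pi.hom_ext
    intro l
    rw [Category.assoc, Pi.lift_π, hg, zero_comp])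

lemma lift_ι {n : ℕ} {W : C} (g : W ⟶ level A (n + 1))
    (hg : ∀ l : Fin (n + 1), g ≫ A.δ l.castSucc = 0) : lift A g hg ≫ ι A (n + 1) = g :=
  kernel.lift_ι _ _ _

lemma ι_δ_last_δ (n : ℕ) (l : Fin (n + 1)) :
    (ι A (n + 2) ≫ A.δ (Fin.last (n + 2))) ≫ A.δ l.castSucc = 0 := by
  have h := A.δ_comp_δ (i := l.castSucc) (j := Fin.last (n + 1)) (Fin.le_last _)
  rw [Fin.succ_last] at h
  rw [Category.assoc, h, ← Category.assoc, ι_δ, zero_comp]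

/-- The boundary morphism `N_{n+1}(A) ⟶ N_n(A)`, the restriction of `∂_{n+1}`. -/
def d : ∀ n : ℕ, obj A (n + 1) ⟶ obj A n
  | 0 => ι A 1 ≫ A.δ (Fin.last 1)
  | n + 1 => lift A (ι A (n + 2) ≫ A.δ (Fin.last (n + 2))) (ι_δ_last_δ A n)

lemma d_ι (n : ℕ) : d A n ≫ ι A n = ι A (n + 1) ≫ A.δ (Fin.last (n + 1)) := by
  cases n
  · exact Category.comp_id _
  · exact lift_ι _ _ (ι_δ_last_δ A _)

lemma d_d (n : ℕ) : d A (n + 1) ≫ d A n = 0 := by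
  have h := A.δ_comp_δ (i := Fin.last (n + 1)) (j := Fin.last (n + 1)) le_rfl
  rw [Fin.succ_last] at h
  rw [← cancel_mono (ι A n), Category.assoc, d_ι, ← Category.assoc, d_ι, Category.assoc, h,
    ← Category.assoc, ι_δ, zero_comp, zero_comp]

variable {A} in
lemma ι_app_δ {B : SimplicialObject C} (f : A ⟶ B) (n : ℕ) (l : Fin (n + 1)) :
    (ι A (n + 1) ≫ f.app (op (.mk (n + 1)))) ≫ B.δ l.castSucc = 0 := by
  rw [Category.assoc, ← SimplicialObject.δ_naturality, ← Category.assoc, ι_δ, zero_comp]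

variable {A} in
/-- The restriction of a simplicial morphism to the Moore complexes. -/
def map {B : SimplicialObject C} (f : A ⟶ B) : ∀ n : ℕ, obj A n ⟶ obj B n
  | 0 => f.app (op (.mk 0))
  | n + 1 => lift B (ι A (n + 1) ≫ f.app (op (.mk (n + 1)))) (ι_app_δ f n)

variable {A} in
lemma map_ι {B : SimplicialObject C} (f : A ⟶ B) (n : ℕ) :
    map f n ≫ ι B n = ι A n ≫ f.app (op (.mk n)) := by
  cases n
  · exact (Category.comp_id _).trans (Category.id_comp _).symm
  · exact lift_ι _ _ (ι_app_δ f _)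

/-- The Moore (normalized) chain complex of a simplicial object. -/
def complex : ChainComplex C ℕ := ChainComplex.of (obj A) (d A) (d_d A)

lemma complex_d (n : ℕ) : (complex A).d (n + 1) n = d A n :=
  ChainComplex.of_d (obj A) (d A) n

variable {A} in
lemma map_d {B : SimplicialObject C} (f : A ⟶ B) (n : ℕ) :
    map f (n + 1) ≫ d B n = d A n ≫ map f n := by
  rw [← cancel_mono (ι B n), Category.assoc, Category.assoc, d_ι, map_ι, ← Category.assoc,
    map_ι, ← Category.assoc, d_ι, Category.assoc, Category.assoc,
    SimplicialObject.δ_naturality]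

variable {A} in
/-- The chain morphism induced by a simplicial morphism. -/
def complexMap {B : SimplicialObject C} (f : A ⟶ B) : complex A ⟶ complex B where
  f n := map f n
  comm' i j hij := by
    obtain rfl : j + 1 = i := hij
    rw [complex_d, complex_d]
    exact map_d f j

lemma map_id (n : ℕ) : map (𝟙 A) n = 𝟙 (obj A n) := by
  rw [← cancel_mono (ι A n), map_ι, Category.id_comp]
  exact Category.comp_id _

variable {A} in
lemma map_comp {B D : SimplicialObject C} (f : A ⟶ B) (g : B ⟶ D) (n : ℕ) :
    map (f ≫ g) n = map f n ≫ map g n := by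
  rw [← cancel_mono (ι D n), map_ι, Category.assoc, map_ι, ← Category.assoc, map_ι,
    Category.assoc]
  rfl

end Moore

/-- The Moore functor `N` from simplicial objects to (positively graded) chain complexes. -/
def moore (C : Type u₁) [Category.{v₁} C] [HasZeroMorphisms C] [HasFiniteLimits C] :
    SimplicialObject C ⥤ ChainComplex C ℕ where
  obj A := Moore.complex A
  map f := Moore.complexMap f
  map_id A := HomologicalComplex.hom_ext _ _ (fun n => Moore.map_id A n)
  map_comp f g := HomologicalComplex.hom_ext _ _ (fun n => Moore.map_comp f g n)

variable {E : Type u₂} [Category.{v₂} E] [HasZeroMorphisms E]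

lemma map_ι_δ (F : C ⥤ E) [F.PreservesZeroMorphisms] (A : SimplicialObject C) (n : ℕ)
    (l : Fin (n + 1)) :
    F.map (Moore.ι A (n + 1)) ≫ ((mapSimplicial F).obj A).δ l.castSucc = 0 :=
  (F.map_comp _ _).symm.trans ((congrArg F.map (Moore.ι_δ A n l)).trans (F.map_zero _ _))

variable [HasFiniteLimits E]

/-- The component in degree `n` of the canonical comparison `F(N(A)) ⟶ N(F(A))`. -/
def mooreComparisonApp (F : C ⥤ E) [F.PreservesZeroMorphisms] (A : SimplicialObject C) :
    ∀ n : ℕ, F.obj (Moore.obj A n) ⟶ Moore.obj ((mapSimplicial F).obj A) n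
  | 0 => 𝟙 (F.obj (level A 0))
  | n + 1 => Moore.lift _ (F.map (Moore.ι A (n + 1))) (map_ι_δ F A n)

lemma mooreComparisonApp_ι (F : C ⥤ E) [F.PreservesZeroMorphisms] (A : SimplicialObject C)
    (n : ℕ) : mooreComparisonApp F A n ≫ Moore.ι ((mapSimplicial F).obj A) n =
      F.map (Moore.ι A n) := by
  cases n
  · exact (Category.comp_id _).trans (F.map_id _).symm
  · exact Moore.lift_ι _ _ (map_ι_δ F A _)

lemma mooreComparisonApp_d (F : C ⥤ E) [F.PreservesZeroMorphisms] (A : SimplicialObject C)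
    (n : ℕ) : mooreComparisonApp F A (n + 1) ≫ Moore.d ((mapSimplicial F).obj A) n =
      F.map (Moore.d A n) ≫ mooreComparisonApp F A n := by
  rw [← cancel_mono (Moore.ι _ n), Category.assoc, Category.assoc, Moore.d_ι,
    mooreComparisonApp_ι, ← Category.assoc, mooreComparisonApp_ι]
  exact (F.map_comp _ _).symm.trans ((congrArg F.map (Moore.d_ι A n).symm).trans
    (F.map_comp _ _))

/-- The canonical comparison `F(N(A)) ⟶ N(F(A))`: in each degree `n` it is the unique morphism
compatible with the inclusions into `F(A_n)`. -/
def mooreComparison (F : C ⥤ E) [F.PreservesZeroMorphisms] (A : SimplicialObject C) :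
    (mapComplex F).obj ((moore C).obj A) ⟶ (moore E).obj ((mapSimplicial F).obj A) where
  f n := mooreComparisonApp F A n
  comm' i j hij := by
    obtain rfl : j + 1 = i := hij
    have h₁ : ((moore E).obj ((mapSimplicial F).obj A)).d (j + 1) j = Moore.d _ j :=
      Moore.complex_d _ j
    have h₂ : ((mapComplex F).obj ((moore C).obj A)).d (j + 1) j = F.map (Moore.d A j) :=
      congrArg F.map (Moore.complex_d A j)
    rw [h₁, h₂]
    exact mooreComparisonApp_d F A j

end Moore

section Resolutions

variable {C : Type u₁} [Category.{v₁} C] [HasZeroMorphisms C]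

/-- A projective (chain) resolution of `X`. -/
structure ChainResolution [HasKernels C] (X : C) where
  /-- the underlying positively graded chain complex -/
  complex : ChainComplex C ℕ
  /-- the augmentation `d_0 : C_0 ⟶ X` -/
  aug : complex.X 0 ⟶ X
  projective : ∀ n : ℕ, IsRegularProjective (complex.X n)
  regularEpi_aug : IsRegularEpi aug
  exact_zero : IsExactPair (complex.d 1 0) aug
  exact_succ : ∀ n : ℕ, IsExactPair (complex.d (n + 2) (n + 1)) (complex.d (n + 1) n)

/-- A (projective) simplicial resolution of `X`: an augmented simplicial object `S` with
`S_{-1} = X`, all of whose `S_n` with `n ≥ 0` are projective, and such that the sequence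
`⋯ ⟶ N_1(S) ⟶ N_0(S) ⟶ X ⟶ 0` is exact. -/
structure SimplicialResolution [HasFiniteLimits C] (X : C) where
  /-- the underlying simplicial object -/
  obj : SimplicialObject C
  /-- the augmentation `∂_0 : S_0 ⟶ X` -/
  aug : level obj 0 ⟶ X
  δ_aug : obj.δ (0 : Fin 2) ≫ aug = obj.δ (1 : Fin 2) ≫ aug
  projective : ∀ n : ℕ, IsRegularProjective (level obj n)
  regularEpi_aug : IsRegularEpi aug
  exact_zero : IsExactPair (((moore C).obj obj).d 1 0) (Moore.ι obj 0 ≫ aug)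
  exact_succ : ∀ n : ℕ, IsExactPair (((moore C).obj obj).d (n + 2) (n + 1))
    (((moore C).obj obj).d (n + 1) n)

variable {E : Type u₂} [Category.{v₂} E] [HasZeroMorphisms E]

/-- Let `R` be a choice of a projective chain resolution `R X` for every object `X`. An `n`-th left
derived functor of `F` (with respect to this choice) is a functor which sends `X` to
`H_n(F(R X))` and a morphism `x : X ⟶ Y` to `H_n(F(φ))`, for every lifting `φ : R X ⟶ R Y`
of `x`. -/
structure LeftDerivedFunctor [HasKernels C] [HasKernels E] [HasCokernels E] (F : C ⥤ E)
    [F.PreservesZeroMorphisms] (R : ∀ X : C, ChainResolution X) (n : ℕ) where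
  /-- the functor `L_n(F)` -/
  functor : C ⥤ E
  /-- the identification `L_n(F)(X) = H_n(F(R X))` -/
  objIso : ∀ X : C, functor.obj X ≅
    (homologyFunctor E n).obj ((mapComplex F).obj (R X).complex)
  map_objIso : ∀ {X Y : C} (x : X ⟶ Y) (φ : (R X).complex ⟶ (R Y).complex),
    φ.f 0 ≫ (R Y).aug = (R X).aug ≫ x →
    functor.map x ≫ (objIso Y).hom =
      (objIso X).hom ≫ (homologyFunctor E n).map ((mapComplex F).map φ)

end Resolutions

section BarrBeck

variable {C : Type u₁} [Category.{v₁} C] (G : Comonad C)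

namespace BarrBeck

/-- The iterates of a comonad: `G^0 X = X` and `G^{n+1} X = G (G^n X)`. -/
def pow (X : C) : ℕ → C
  | 0 => X
  | n + 1 => G.obj (pow X n)

/-- The iterates of a comonad act on morphisms. -/
def powMap {X Y : C} (x : X ⟶ Y) : ∀ n : ℕ, pow G X n ⟶ pow G Y n
  | 0 => x
  | n + 1 => G.map (powMap x n)

lemma powMap_id (X : C) (n : ℕ) : powMap G (𝟙 X) n = 𝟙 (pow G X n) := by
  induction n with
  | zero => rfl
  | succ n ih => exact (congrArg G.map ih).trans (G.map_id _)

lemma powMap_comp {X Y Z : C} (x : X ⟶ Y) (y : Y ⟶ Z) (n : ℕ) :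
    powMap G (x ≫ y) n = powMap G x n ≫ powMap G y n := by
  induction n with
  | zero => rfl
  | succ n ih => exact (congrArg G.map ih).trans (G.map_comp _ _)

/-- The counit `ε : G^{n+1} X ⟶ G^n X` at `G^n X`. -/
def counit (X : C) (n : ℕ) : pow G X (n + 1) ⟶ pow G X n := G.ε.app (pow G X n)

/-- The comultiplication `δ : G^{n+1} X ⟶ G^{n+2} X` at `G^n X`. -/
def comult (X : C) (n : ℕ) : pow G X (n + 1) ⟶ pow G X (n + 2) := G.δ.app (pow G X n)

variable {G} in
/-- The action of `G` on morphisms between iterates. -/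
def app {X Y : C} {m n : ℕ} (x : pow G X m ⟶ pow G Y n) : pow G X (m + 1) ⟶ pow G Y (n + 1) :=
  G.map x

lemma app_comp {X Y Z : C} {m n p : ℕ} (x : pow G X m ⟶ pow G Y n) (y : pow G Y n ⟶ pow G Z p) :
    app (x ≫ y) = app x ≫ app y := G.map_comp x y

lemma app_counit {X Y : C} {m n : ℕ} (x : pow G X m ⟶ pow G Y n) :
    app x ≫ counit G Y n = counit G X m ≫ x := G.ε.naturality x

lemma app_comult {X Y : C} {m n : ℕ} (x : pow G X m ⟶ pow G Y n) :
    app x ≫ comult G Y n = comult G X m ≫ app (app x) := G.δ.naturality x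

lemma comult_counit (X : C) (n : ℕ) : comult G X n ≫ counit G X (n + 1) = 𝟙 _ :=
  G.left_counit (pow G X n)

lemma comult_app_counit (X : C) (n : ℕ) : comult G X n ≫ app (counit G X n) = 𝟙 _ :=
  G.right_counit (pow G X n)

lemma comult_app_comult (X : C) (n : ℕ) :
    comult G X n ≫ app (comult G X n) = comult G X n ≫ comult G X (n + 1) :=
  G.coassoc (pow G X n)

/-- The restriction of a monotone map to the nonzero elements. -/
def tail {m n : ℕ} (f : Fin (m + 1) →o Fin n) : Fin m →o Fin n where
  toFun i := f i.succ
  monotone' _ _ h := f.monotone (Fin.succ_le_succ_iff.2 h)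

lemma ne_zero {m n : ℕ} (f : Fin (m + 1) →o Fin (n + 1)) (h : f 0 ≠ 0) (i : Fin (m + 1)) :
    f i ≠ 0 :=
  fun hi => h (Fin.le_zero_iff.1 (hi ▸ f.monotone (Fin.zero_le i)))

/-- A monotone map which does not attain `0`, with all values lowered by `1`. -/
def pred {m n : ℕ} (f : Fin (m + 1) →o Fin (n + 1)) (h : f 0 ≠ 0) : Fin (m + 1) →o Fin n where
  toFun i := (f i).pred (ne_zero f h i)
  monotone' _ _ hij := Fin.pred_le_pred_iff.2 (f.monotone hij)

/-- The empty monotone map. -/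
def empty (n : ℕ) : Fin 0 →o Fin n := ⟨fun i => i.elim0, fun i => i.elim0⟩

/-- The action `G^n X ⟶ G^m X` of a monotone map `f : {0, …, m - 1} ⟶ {0, …, n - 1}`: the counit
removes the factors of `G^n` which are not in the image of `f`, and the comultiplication
duplicates those which are attained more than once. -/
def act (X : C) : ∀ (m n : ℕ), (Fin m →o Fin n) → (pow G X n ⟶ pow G X m)
  | 0, 0, _ => 𝟙 (pow G X 0)
  | 0, n + 1, _ => counit G X n ≫ act X 0 n (empty n)
  | _ + 1, 0, f => (f 0).elim0
  | m + 1, n + 1, f =>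
    if h : f 0 = 0 then comult G X n ≫ app (act X m (n + 1) (tail f))
    else counit G X n ≫ act X (m + 1) n (pred f h)
termination_by m n => (m, n)

lemma act_skip (X : C) {m n : ℕ} (f : Fin m →o Fin (n + 1)) (f' : Fin m →o Fin n)
    (h : ∀ i, f i = (f' i).succ) : act G X m (n + 1) f = counit G X n ≫ act G X m n f' := by
  cases m with
  | zero =>
    rw [act, show empty n = f' from OrderHom.ext _ _ (funext fun i => i.elim0)]
  | succ m =>
    have h0 : f 0 ≠ 0 := by rw [h]; exact Fin.succ_ne_zero _
    rw [act, dif_neg h0, show pred f h0 = f' from OrderHom.ext _ _ (funext fun i => by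
      simp [pred, h])]

lemma act_hit (X : C) {m n : ℕ} (f : Fin (m + 1) →o Fin (n + 1))
    (h0 : f 0 = 0) : act G X (m + 1) (n + 1) f = comult G X n ≫ app (act G X m (n + 1) (tail f)) := by
  rw [act, dif_pos h0]

lemma skip_or_hit {m n : ℕ} (f : Fin m →o Fin (n + 1)) :
    (∃ f' : Fin m →o Fin n, ∀ i, f i = (f' i).succ) ∨ ∃ h : 0 < m, f ⟨0, h⟩ = 0 := by
  cases m with
  | zero => exact Or.inl ⟨empty n, fun i => i.elim0⟩
  | succ m =>
    by_cases h : f 0 = 0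
    · exact Or.inr ⟨m.succ_pos, h⟩
    · exact Or.inl ⟨pred f h, fun i => (Fin.succ_pred (f i) (ne_zero f h i)).symm⟩

lemma act_id (X : C) (n : ℕ) : act G X n n OrderHom.id = 𝟙 (pow G X n) := by
  induction n with
  | zero => rw [act]
  | succ n ih =>
    rw [act_hit G X OrderHom.id rfl,
      act_skip G X (tail OrderHom.id) OrderHom.id (fun _ => rfl), ih, Category.comp_id,
      comult_app_counit]

lemma act_comp (X : C) : ∀ (m n p : ℕ) (f : Fin m →o Fin n) (g : Fin n →o Fin p),
    act G X m p (g.comp f) = act G X n p g ≫ act G X m n f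
  | 0, 0, 0, f, g => by simp [act]
  | _, n + 1, 0, f, g => (g 0).elim0
  | m + 1, 0, _, f, g => (f 0).elim0
  | m, n, p + 1, f, g => by
    rcases skip_or_hit g with ⟨g', hg⟩ | ⟨h, hg⟩
    · rw [act_skip G X g g' hg, act_skip G X (g.comp f) (g'.comp f) (fun i => hg (f i)),
        act_comp X m n p f g', Category.assoc]
    · obtain ⟨n, rfl⟩ : ∃ k, n = k + 1 := ⟨n - 1, by omega⟩
      rcases skip_or_hit f with ⟨f', hf⟩ | ⟨h', hf⟩
      · have e : g.comp f = (tail g).comp f' :=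
          OrderHom.ext _ _ (funext fun i => congrArg g (hf i))
        rw [e, act_comp X m n (p + 1) f' (tail g), act_skip G X f f' hf, act_hit G X g hg,
          Category.assoc, ← Category.assoc (app _), app_counit, Category.assoc,
          ← Category.assoc (comult G X p), comult_counit, Category.id_comp]
      · obtain ⟨m, rfl⟩ : ∃ k, m = k + 1 := ⟨m - 1, by omega⟩
        have h0 : (g.comp f) 0 = 0 := (congrArg g hf).trans hg
        have e : tail (g.comp f) = g.comp (tail f) := rfl
        rw [act_hit G X (g.comp f) h0, e, act_comp X m (n + 1) (p + 1) (tail f) g,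
          act_hit G X f hf, act_hit G X g hg, app_comp, app_comp, Category.assoc, Category.assoc,
          ← Category.assoc (app _) (comult _ _ _), app_comult, Category.assoc,
          ← Category.assoc, comult_app_comult, Category.assoc]
termination_by m n p => m + n + p

lemma act_naturality {X Y : C} (x : X ⟶ Y) : ∀ (m n : ℕ) (f : Fin m →o Fin n),
    powMap G x n ≫ act G Y m n f = act G X m n f ≫ powMap G x m
  | 0, 0, _ => by simp [act]
  | _ + 1, 0, f => (f 0).elim0
  | m, n + 1, f => by
    rcases skip_or_hit f with ⟨f', hf⟩ | ⟨h, hf⟩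
    · rw [act_skip G X f f' hf, act_skip G Y f f' hf, Category.assoc,
        ← act_naturality x m n f', ← Category.assoc, ← Category.assoc]
      exact congrArg (· ≫ _) (app_counit G (powMap G x n))
    · obtain ⟨m, rfl⟩ : ∃ k, m = k + 1 := ⟨m - 1, by omega⟩
      have h₁ : powMap G x (n + 1) ≫ comult G Y n = comult G X n ≫ app (powMap G x (n + 1)) :=
        app_comult G (powMap G x n)
      have h₂ : app (act G X m (n + 1) (tail f)) ≫ powMap G x (m + 1) =
          app (act G X m (n + 1) (tail f) ≫ powMap G x m) := (app_comp G _ _).symm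
      rw [act_hit G X f hf, act_hit G Y f hf, Category.assoc, h₂,
        ← act_naturality x m (n + 1) (tail f), app_comp, ← Category.assoc, h₁, Category.assoc]
termination_by m n => m + n

end BarrBeck

open BarrBeck

/-- The simplicial object `G(X)` of a comonad `G`, natural in `X`: `G(X)_n = G^{n+1} X`, with face
and degeneracy operators `∂_i = G^i ε G^{n-i}` and `σ_i = G^i δ G^{n-i}`. -/
def barrBeckObject : C ⥤ SimplicialObject C where
  obj X :=
    { obj := fun n => pow G X (n.unop.len + 1)
      map := fun {n m} f => act G X (m.unop.len + 1) (n.unop.len + 1) f.unop.toOrderHom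
      map_id := fun n => act_id G X _
      map_comp := fun f g => act_comp G X _ _ _ g.unop.toOrderHom f.unop.toOrderHom }
  map x :=
    { app := fun n => powMap G x (n.unop.len + 1)
      naturality := fun _ _ f => (act_naturality G x _ _ f.unop.toOrderHom).symm }
  map_id X := by
    ext n
    exact powMap_id G X _
  map_comp x y := by
    ext n
    exact powMap_comp G x y _

/-- The simplicially derived functors of `F` with respect to the comonad `G`: in degree `n`,
`H_{n+1}(X, F)_G = H_n(N(F(G(X))))` (with the customary dimension shift). -/
def simplicialDerived {E : Type u₂} [Category.{v₂} E] [HasZeroMorphisms E] [HasFiniteLimits E]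
    [HasCokernels E] (F : C ⥤ E) (n : ℕ) : C ⥤ E :=
  barrBeckObject G ⋙ mapSimplicial F ⋙ moore E ⋙ homologyFunctor E n

end BarrBeck

section Varieties

/-- The terms over a set `X` of variables, in the signature with operations `Op` of arities `ar`. -/
inductive Term {Op : Type w} (ar : Op → ℕ) (X : Type w) : Type w
  | var (x : X) : Term ar X
  | op (o : Op) (t : Fin (ar o) → Term ar X) : Term ar X

/-- The value of a term under an interpretation of the operations and a valuation. -/
def Term.eval {Op : Type w} {ar : Op → ℕ} {X A : Type w}
    (i : ∀ o : Op, (Fin (ar o) → A) → A) (v : X → A) : Term ar X → A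
  | .var x => v x
  | .op o t => i o (fun k => (t k).eval i v)

/-- A presentation of a (one-sorted, finitary) variety of algebras: a signature and a set of
identities between terms in countably many variables. -/
structure Variety : Type (w + 1) where
  /-- the operation symbols -/
  Op : Type w
  /-- the arity of an operation symbol -/
  arity : Op → ℕ
  /-- the identities -/
  identities : Set (Term arity (ULift.{w} ℕ) × Term arity (ULift.{w} ℕ))

namespace Variety

/-- An algebra of the variety `V`: a set with operations which satisfy the identities of `V`. -/
structure Alg (V : Variety.{w}) : Type (w + 1) where
  /-- the underlying set -/
  carrier : Type w
  /-- the operations -/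
  op : ∀ o : V.Op, (Fin (V.arity o) → carrier) → carrier
  sat : ∀ p ∈ V.identities, ∀ v : ULift.{w} ℕ → carrier, p.1.eval op v = p.2.eval op v

variable {V : Variety.{w}}

/-- A homomorphism of algebras: a map which preserves the operations. -/
@[ext]
structure Hom (A B : V.Alg) : Type w where
  /-- the underlying map -/
  toFun : A.carrier → B.carrier
  map_op : ∀ (o : V.Op) (a : Fin (V.arity o) → A.carrier),
    toFun (A.op o a) = B.op o (fun k => toFun (a k))

/-- The category of algebras of a variety. -/
instance : Category.{w} V.Alg where
  Hom A B := Hom A B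
  id A := ⟨fun a => a, fun _ _ => rfl⟩
  comp f g := ⟨fun a => g.toFun (f.toFun a), fun o a => by rw [f.map_op, g.map_op]⟩

/-- The forgetful functor from a variety to the category of sets. -/
def forget (V : Variety.{w}) : V.Alg ⥤ Type w where
  obj A := A.carrier
  map f := ↾(Hom.toFun f)

/-- Terms with the same value in all algebras of the variety. -/
def freeSetoid (V : Variety.{w}) (X : Type w) : Setoid (Term V.arity X) where
  r s t := ∀ (A : V.Alg) (v : X → A.carrier), s.eval A.op v = t.eval A.op v
  iseqv := ⟨fun _ _ _ => rfl, fun h A v => (h A v).symm,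
    fun h h' A v => (h A v).trans (h' A v)⟩

/-- The operations on classes of terms. -/
def freeOp (V : Variety.{w}) (X : Type w) (o : V.Op)
    (a : Fin (V.arity o) → Quotient (freeSetoid V X)) : Quotient (freeSetoid V X) :=
  Quotient.mk _ (.op o (fun k => (a k).out))

/-- The value of a class of terms. -/
def freeEval {X : Type w} (A : V.Alg) (v : X → A.carrier) :
    Quotient (freeSetoid V X) → A.carrier :=
  Quotient.lift (Term.eval A.op v) (fun _ _ h => h A v)

lemma freeEval_freeOp {X : Type w} (A : V.Alg) (v : X → A.carrier) (o : V.Op)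
    (a : Fin (V.arity o) → Quotient (freeSetoid V X)) :
    freeEval A v (freeOp V X o a) = A.op o (fun k => freeEval A v (a k)) :=
  congrArg (A.op o) (funext fun k => congrArg (freeEval A v) (Quotient.out_eq (a k)))

lemma map_eval {Op : Type w} {ar : Op → ℕ} {A B X : Type w} (i : ∀ o : Op, (Fin (ar o) → A) → A)
    (j : ∀ o : Op, (Fin (ar o) → B) → B) (f : A → B)
    (hf : ∀ (o : Op) (a : Fin (ar o) → A), f (i o a) = j o (fun k => f (a k))) (v : X → A)
    (t : Term ar X) : f (t.eval i v) = t.eval j (fun x => f (v x)) := by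
  induction t with
  | var x => rfl
  | op o t ih => exact (hf o _).trans (congrArg (j o) (funext ih))

lemma free_ext {X : Type w} (a b : Quotient (freeSetoid V X))
    (h : ∀ (A : V.Alg) (v : X → A.carrier), freeEval A v a = freeEval A v b) : a = b := by
  induction a using Quotient.inductionOn
  induction b using Quotient.inductionOn
  exact Quotient.sound h

/-- The free algebra on a set: terms modulo the identities which hold in all algebras. -/
def freeAlg (V : Variety.{w}) (X : Type w) : V.Alg where
  carrier := Quotient (freeSetoid V X)
  op := freeOp V X
  sat p hp v := free_ext _ _ fun A u => by
    rw [map_eval _ A.op (freeEval A u) (freeEval_freeOp A u),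
      map_eval _ A.op (freeEval A u) (freeEval_freeOp A u)]
    exact A.sat p hp _

lemma freeAlg_eval (V : Variety.{w}) (X : Type w) (t : Term V.arity X) :
    t.eval (freeOp V X) (fun x => Quotient.mk _ (.var x)) = Quotient.mk _ t := by
  refine free_ext _ _ fun A u => ?_
  rw [map_eval _ A.op (freeEval A u) (freeEval_freeOp A u)]
  rfl

/-- The universal property of the free algebra. -/
def freeEquiv (X : Type w) (A : V.Alg) : (freeAlg V X ⟶ A) ≃ (X ⟶ (forget V).obj A) where
  toFun f := ↾(fun x => Hom.toFun f (Quotient.mk _ (.var x)))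
  invFun v := Hom.mk (A := freeAlg V X) (freeEval A v) (freeEval_freeOp A v)
  left_inv f := by
    refine Hom.ext (funext fun a => ?_)
    induction a using Quotient.inductionOn with
    | h t =>
      refine Eq.trans ?_ (congrArg (Hom.toFun f) (freeAlg_eval V X t))
      exact (map_eval (freeOp V X) A.op (Hom.toFun f) (Hom.map_op f) _ t).symm
  right_inv v := rfl

/-- Free algebras exist: the forgetful functor has a left adjoint. -/
instance (V : Variety.{w}) : (forget V).IsRightAdjoint :=
  (Adjunction.adjunctionOfEquivLeft (G := forget V) (F_obj := freeAlg V)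
    (fun X A => freeEquiv X A) (fun _ _ _ _ _ => rfl)).isRightAdjoint

end Variety

end Varieties

end NonAdditive

end

open NonAdditive

/-!
The two halves of the theorem rest on two facts.

*Liftings are unique up to an imaginary homotopy.* Let `φ, ψ : K ⟶ Q` be chain morphisms from a
complex of projectives to a resolution which agree on the augmentation. In the abelian case
`φ - ψ` is null-homotopic. Here a difference `a - b` of morphisms `A ⟶ B` only exists as an
imaginary morphism `D(A) ⟶ B`, where `D(A)` is the kernel of the codiagonal `A ⨿ A ⟶ A`. By
Condition (P), `D` preserves projectives, so the usual recursion for the null-homotopy of `φ - ψ`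
still works, at the cost of one more application of `D` in each degree
(`exists_isNullHomotopyComponent`). Since `F` preserves kernels of split epimorphisms, there is
a natural comparison `D(F(A)) ⟶ F(D(A))`, through which a cycle `Z ⟶ F(K_n)` can be fed into the
homotopy. The result is that `F(φ) - F(ψ)` is a boundary on cycles after precomposition with the
imaginary identity `D^n(D(Z)) ⟶ D(Z)`. The latter is an epimorphism, and a pair of morphisms with
zero difference is equal, both because of protomodularity; so `φ` and `ψ` induce the same morphism
on `H_n(F(-))` (`homology_map_eq`). Independence of the resolution, and the existence and
functoriality of the derived functors, follow formally.

*Moore complexes.* The object `N_n(A)` is an iterated kernel of split epimorphisms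
(`exists_isPartialMoore`). Hence a protoadditive functor commutes with `N`
(`isIso_mooreComparison`), and the Moore complex of a simplicial resolution is a chain resolution by
Condition (P). Together these prove the comparison of simplicial and chain resolutions.

For a variety it remains to see that the comonad resolution is a simplicial resolution. The unit of
the free-forgetful adjunction contracts the augmented simplicial sets of its elements, but not by
morphisms that preserve zero, so exactness of the Moore complex is not immediate. It comes from the
Kan condition, which holds for every simplicial object of a homological category (`exists_filler`):
the images of a sphere under the contraction form a horn, and the missing face of a filler of this
horn is a simplex which bounds the sphere (`exists_of_horn`).
-/

noncomputable section

namespace NonAdditive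

/-! ### Kernels and projectives in homological categories -/

section Homological

variable {C : Type u₁} [Category.{v₁} C] [HasZeroMorphisms C]

/-- In a homological category, a section of a split epimorphism and its kernel are jointly epic. -/
lemma hom_ext_of_splitEpi [IsHomological C] {K X Y Z : C} {k : K ⟶ X} {f : X ⟶ Y} {s : Y ⟶ X}
    (hs : s ≫ f = 𝟙 Y) (hk : IsKernelOf k f) {u v : X ⟶ Z} (h₁ : k ≫ u = k ≫ v)
    (h₂ : s ≫ u = s ≫ v) : u = v := by
  have : IsIso (equalizer.ι u v) := IsHomological.protomodular k f s (equalizer.ι u v)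
    (equalizer.lift k h₁) (equalizer.lift s h₂) hs hk inferInstance (equalizer.lift_ι _ _)
    (equalizer.lift_ι _ _)
  rw [← cancel_epi (equalizer.ι u v), equalizer.condition]

lemma isKernelOf_kernel {X Y : C} (f : X ⟶ Y) [HasKernel f] : IsKernelOf (kernel.ι f) f :=
  ⟨kernel.condition f, ⟨kernelIsKernel f⟩⟩

lemma IsKernelOf.zero {K X Y : C} {k : K ⟶ X} {f : X ⟶ Y} (h : IsKernelOf k f) : k ≫ f = 0 := h.1

lemma IsKernelOf.mono {K X Y : C} {k : K ⟶ X} {f : X ⟶ Y} (h : IsKernelOf k f) : Mono k := by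
  obtain ⟨w, ⟨hl⟩⟩ := h
  exact ⟨fun a b hab => Fork.IsLimit.hom_ext hl hab⟩

lemma IsKernelOf.exists_lift {K X Y W : C} {k : K ⟶ X} {f : X ⟶ Y} (h : IsKernelOf k f)
    (t : W ⟶ X) (ht : t ≫ f = 0) : ∃ l : W ⟶ K, l ≫ k = t := by
  obtain ⟨w, ⟨hl⟩⟩ := h
  exact ⟨_, (KernelFork.IsLimit.lift' hl t ht).2⟩

lemma isKernelOf_of_exists_lift {K X Y : C} {k : K ⟶ X} {f : X ⟶ Y} [Mono k] (w : k ≫ f = 0)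
    (h : ∀ {W : C} (t : W ⟶ X), t ≫ f = 0 → ∃ l : W ⟶ K, l ≫ k = t) : IsKernelOf k f :=
  ⟨w, ⟨KernelFork.IsLimit.ofι' k w fun t ht => ⟨(h t ht).choose, (h t ht).choose_spec⟩⟩⟩

/-- Over an exact pair, projectivity solves lifting problems. -/
lemma IsExactPair.exists_lift [HasKernels C] {A B D P : C} {f : A ⟶ B} {g : B ⟶ D}
    (h : IsExactPair f g) (hP : IsRegularProjective P) (z : P ⟶ B) (hz : z ≫ g = 0) :
    ∃ y : P ⟶ A, y ≫ f = z := by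
  obtain ⟨w, hr⟩ := h
  obtain ⟨y, hy⟩ := hP _ (kernel.lift g z hz) hr
  exact ⟨y, by rw [← kernel.lift_ι g f w, reassoc_of% hy, kernel.lift_ι]⟩

lemma IsExactPair.isProper [HasKernels C] {A B D : C} {f : A ⟶ B} {g : B ⟶ D}
    (h : IsExactPair f g) : IsProper f := by
  obtain ⟨w, hr⟩ := h
  exact ⟨kernel g, kernel.lift g f w, kernel.ι g, hr,
    ⟨⟨D, g, kernel.condition g, kernelIsKernel g⟩⟩, kernel.lift_ι _ _ _⟩

end Homological

/-! ### Difference objects and imaginary morphisms -/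

section Differences

variable {C : Type u₁} [Category.{v₁} C] [HasZeroMorphisms C] [HasKernels C]
  [HasBinaryCoproducts C]

/-- The difference object `D(A)` is the kernel of the codiagonal `A ⨿ A ⟶ A`. A morphism
`D(A) ⟶ B` is an imaginary morphism from `A` to `B`: a pair `a, b : A ⟶ B` has its difference
`D(A) ⟶ A ⨿ A ⟶ B` of this kind, although it has none of the form `A ⟶ B`. -/
def difference (C : Type u₁) [Category.{v₁} C] [HasZeroMorphisms C] [HasKernels C]
    [HasBinaryCoproducts C] : C ⥤ C where
  obj A := kernel (coprod.desc (𝟙 A) (𝟙 A))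
  map {A B} f := kernel.lift _ (kernel.ι (coprod.desc (𝟙 A) (𝟙 A)) ≫ coprod.map f f) (by
    have : coprod.map f f ≫ coprod.desc (𝟙 B) (𝟙 B) = coprod.desc (𝟙 A) (𝟙 A) ≫ f := by simp
    rw [Category.assoc, this, kernel.condition_assoc, zero_comp])
  map_id A := by simp
  map_comp f g := by simp [← cancel_mono (kernel.ι _)]

attribute [local simp] coprod.inl_desc coprod.inr_desc coprod.inl_desc_assoc coprod.inr_desc_assoc

namespace difference

/-- The inclusion `D(A) ⟶ A ⨿ A`. -/
def ι (A : C) : (difference C).obj A ⟶ A ⨿ A := kernel.ι (coprod.desc (𝟙 A) (𝟙 A))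

instance (A : C) : Mono (ι A) := inferInstanceAs (Mono (kernel.ι _))

lemma map_ι {A B : C} (f : A ⟶ B) : (difference C).map f ≫ ι B = ι A ≫ coprod.map f f :=
  kernel.lift_ι _ _ _

lemma isKernelOf_ι (A : C) : IsKernelOf (ι A) (coprod.desc (𝟙 A) (𝟙 A)) := isKernelOf_kernel _

instance : (difference C).PreservesZeroMorphisms where
  map_zero A B := by
    rw [← cancel_mono (ι B), map_ι, zero_comp]
    have : coprod.map (0 : A ⟶ B) (0 : A ⟶ B) = 0 := by ext <;> simp
    rw [this, comp_zero]

/-- The difference of two morphisms, as an imaginary morphism. -/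
def sub {A B : C} (a b : A ⟶ B) : (difference C).obj A ⟶ B := ι A ≫ coprod.desc a b

lemma sub_comp {A B T : C} (a b : A ⟶ B) (t : B ⟶ T) : sub a b ≫ t = sub (a ≫ t) (b ≫ t) := by
  simp [sub]

lemma map_sub {A' A B : C} (f : A' ⟶ A) (a b : A ⟶ B) :
    (difference C).map f ≫ sub a b = sub (f ≫ a) (f ≫ b) := by
  rw [sub, ← Category.assoc, map_ι, Category.assoc, coprod.map_desc, sub]

lemma sub_self {A B : C} (a : A ⟶ B) : sub a a = 0 := by
  have : coprod.desc a a = coprod.desc (𝟙 A) (𝟙 A) ≫ a := by simp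
  rw [sub, this, reassoc_of% (isKernelOf_ι A).zero, zero_comp]

/-- The kernel `D(A) ⟶ A ⨿ A` of the codiagonal and its section `A ⟶ A ⨿ A` are jointly epic. -/
lemma eq_of_sub_eq_zero [IsHomological C] {A B : C} {a b : A ⟶ B} (h : sub a b = 0) : a = b := by
  have h' : coprod.desc a b = coprod.desc a a :=
    hom_ext_of_splitEpi (s := coprod.inl) (coprod.inl_desc _ _) (isKernelOf_ι A)
      (h.trans (sub_self a).symm) (by simp)
  simpa using congr(coprod.inr ≫ $h').symm

/-- The imaginary identity `D(A) ⟶ A`, the difference of `𝟙` and `0`. -/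
def toSelf (A : C) : (difference C).obj A ⟶ A := sub (𝟙 A) 0

lemma toSelf_comp {A B : C} (a : A ⟶ B) : toSelf A ≫ a = sub a 0 := by
  rw [toSelf, sub_comp, Category.id_comp, zero_comp]

lemma epi_toSelf [IsHomological C] (A : C) : Epi (toSelf A) := ⟨fun {Z} u v h => by
  rw [toSelf_comp, toSelf_comp] at h
  have h' : coprod.desc u 0 = coprod.desc v 0 :=
    hom_ext_of_splitEpi (s := coprod.inr) (coprod.inr_desc _ _) (isKernelOf_ι A) h (by simp)
  simpa using congr(coprod.inl ≫ $h')⟩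

end difference

lemma isRegularProjective_difference (hP : ConditionP C) {A : C} (hA : IsRegularProjective A) :
    IsRegularProjective ((difference C).obj A) := by
  refine hP _ _ ⟨⟨⟨coprod.inl, coprod.inl_desc _ _⟩⟩⟩ (difference.isKernelOf_ι A) ?_
  intro X Y p f hp
  obtain ⟨a, ha⟩ := hA p (coprod.inl ≫ f) hp
  obtain ⟨b, hb⟩ := hA p (coprod.inr ≫ f) hp
  exact ⟨coprod.desc a b, by ext <;> simp [ha, hb]⟩

/-- The iterates of the difference functor. -/
def differencePow (C : Type u₁) [Category.{v₁} C] [HasZeroMorphisms C] [HasKernels C]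
    [HasBinaryCoproducts C] : ℕ → (C ⥤ C)
  | 0 => 𝟭 C
  | n + 1 => differencePow C n ⋙ difference C

namespace differencePow

instance preservesZeroMorphisms : ∀ n : ℕ, (differencePow C n).PreservesZeroMorphisms
  | 0 => inferInstanceAs (𝟭 C).PreservesZeroMorphisms
  | n + 1 =>
    have := preservesZeroMorphisms n
    inferInstanceAs (differencePow C n ⋙ difference C).PreservesZeroMorphisms

/-- The iterated imaginary identity `D^n(A) ⟶ A`. -/
def toSelf (A : C) : ∀ n : ℕ, (differencePow C n).obj A ⟶ A
  | 0 => 𝟙 A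
  | n + 1 => difference.sub (toSelf A n) 0

lemma epi_toSelf [IsHomological C] (A : C) : ∀ n : ℕ, Epi (toSelf A n)
  | 0 => inferInstanceAs (Epi (𝟙 A))
  | n + 1 => by
    have := epi_toSelf A n
    have := difference.epi_toSelf ((differencePow C n).obj A)
    change Epi (difference.sub (toSelf A n) 0)
    rw [← difference.toSelf_comp]
    exact epi_comp (difference.toSelf _) (toSelf A n)

lemma map_toSelf {A B : C} (f : A ⟶ B) :
    ∀ n : ℕ, (differencePow C n).map f ≫ toSelf B n = toSelf A n ≫ f
  | 0 => (Category.comp_id f).trans (Category.id_comp f).symm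
  | n + 1 =>
    calc (difference C).map ((differencePow C n).map f) ≫ difference.sub (toSelf B n) 0
        = difference.sub (toSelf A n ≫ f) 0 := by
          rw [difference.map_sub, map_toSelf f n, comp_zero]
      _ = difference.sub (toSelf A n) 0 ≫ f := by rw [difference.sub_comp, zero_comp]

end differencePow

lemma isRegularProjective_differencePow (hP : ConditionP C) {A : C} (hA : IsRegularProjective A) :
    ∀ n : ℕ, IsRegularProjective ((differencePow C n).obj A)
  | 0 => hA
  | n + 1 => isRegularProjective_difference hP (isRegularProjective_differencePow hP hA n)

end Differences

/-! ### Difference objects and protoadditive functors -/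

section ProtoadditiveDifferences

variable {C : Type u₁} [Category.{v₁} C] [HasZeroMorphisms C] [HasKernels C]
  [HasBinaryCoproducts C] {E : Type u₂} [Category.{v₂} E] [HasZeroMorphisms E]
  (F : C ⥤ E) [IsProtoadditive F]

lemma isKernelOf_map_difference_ι (A : C) :
    IsKernelOf (F.map (difference.ι A)) (F.map (coprod.desc (𝟙 A) (𝟙 A))) :=
  IsProtoadditive.map_kernel _ _ ⟨⟨⟨coprod.inl, coprod.inl_desc _ _⟩⟩⟩ (difference.isKernelOf_ι A)

variable [HasKernels E] [HasBinaryCoproducts E]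

lemma exists_differenceComparison (A : C) :
    ∃ l : (difference E).obj (F.obj A) ⟶ F.obj ((difference C).obj A),
      l ≫ F.map (difference.ι A) = difference.ι (F.obj A) ≫ coprodComparison F A A := by
  refine (isKernelOf_map_difference_ι F A).exists_lift _ ?_
  have : coprodComparison F A A ≫ F.map (coprod.desc (𝟙 A) (𝟙 A)) =
      coprod.desc (𝟙 (F.obj A)) (𝟙 (F.obj A)) := by
    ext <;> simp [coprodComparison, ← F.map_comp, coprod.inl_desc, coprod.inr_desc]
  rw [Category.assoc, this, (difference.isKernelOf_ι _).zero]

/-- The canonical comparison `D(F(A)) ⟶ F(D(A))`. -/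
def differenceComparison (A : C) : (difference E).obj (F.obj A) ⟶ F.obj ((difference C).obj A) :=
  (exists_differenceComparison F A).choose

lemma differenceComparison_ι (A : C) : differenceComparison F A ≫ F.map (difference.ι A) =
    difference.ι (F.obj A) ≫ coprodComparison F A A :=
  (exists_differenceComparison F A).choose_spec

lemma differenceComparison_naturality {A B : C} (f : A ⟶ B) :
    (difference E).map (F.map f) ≫ differenceComparison F B =
      differenceComparison F A ≫ F.map ((difference C).map f) := by
  have := (isKernelOf_map_difference_ι F B).mono
  rw [← cancel_mono (F.map (difference.ι B)), Category.assoc, Category.assoc,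
    differenceComparison_ι, ← F.map_comp, difference.map_ι, F.map_comp,
    reassoc_of% differenceComparison_ι F A, ← Category.assoc, difference.map_ι, Category.assoc,
    coprodComparison_natural]

lemma differenceComparison_map_sub {A B : C} (a b : A ⟶ B) :
    differenceComparison F A ≫ F.map (difference.sub a b) =
      difference.sub (F.map a) (F.map b) := by
  have : coprodComparison F A A ≫ F.map (coprod.desc a b) = coprod.desc (F.map a) (F.map b) := by
    ext <;> simp [coprodComparison, ← F.map_comp, coprod.inl_desc, coprod.inr_desc]
  rw [difference.sub, F.map_comp, reassoc_of% differenceComparison_ι F A, this, difference.sub]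

/-- A morphism `Z ⟶ F(A)` induces morphisms `D^n(Z) ⟶ F(D^n(A))`. -/
def differencePowLift {Z : E} {A : C} (x : Z ⟶ F.obj A) :
    ∀ n : ℕ, (differencePow E n).obj Z ⟶ F.obj ((differencePow C n).obj A)
  | 0 => x
  | n + 1 => (difference E).map (differencePowLift x n) ≫ differenceComparison F _

lemma differencePowLift_succ_map_sub {Z : E} {A B : C} (x : Z ⟶ F.obj A) (n : ℕ)
    (a b : (differencePow C n).obj A ⟶ B) :
    differencePowLift F x (n + 1) ≫ F.map (difference.sub a b) =
      difference.sub (differencePowLift F x n ≫ F.map a) (differencePowLift F x n ≫ F.map b) :=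
  calc ((difference E).map (differencePowLift F x n) ≫ differenceComparison F _) ≫
        F.map (difference.sub a b)
      = _ := by rw [Category.assoc, differenceComparison_map_sub, difference.map_sub]

lemma differencePowLift_map {Z : E} {A B : C} (x : Z ⟶ F.obj A) (f : A ⟶ B) :
    ∀ n : ℕ, differencePowLift F x n ≫ F.map ((differencePow C n).map f) =
      differencePowLift F (x ≫ F.map f) n
  | 0 => rfl
  | n + 1 =>
    calc ((difference E).map (differencePowLift F x n) ≫ differenceComparison F _) ≫
          F.map ((difference C).map ((differencePow C n).map f))
        = (difference E).map (differencePowLift F x n ≫ F.map ((differencePow C n).map f)) ≫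
          differenceComparison F _ := by
          rw [Category.assoc, ← differenceComparison_naturality, Functor.map_comp, Category.assoc]
      _ = (difference E).map (differencePowLift F (x ≫ F.map f) n) ≫
          differenceComparison F _ := by rw [differencePowLift_map x f n]

lemma differencePowLift_zero (Z : E) (A : C) :
    ∀ n : ℕ, differencePowLift F (0 : Z ⟶ F.obj A) n = 0
  | 0 => rfl
  | n + 1 =>
    calc (difference E).map (differencePowLift F (0 : Z ⟶ F.obj A) n) ≫ differenceComparison F _
        = 0 := by rw [differencePowLift_zero Z A n, Functor.map_zero, zero_comp]

lemma differencePowLift_toSelf [HasZeroObject C] {Z : E} {A : C} (x : Z ⟶ F.obj A) :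
    ∀ n : ℕ, differencePowLift F x n ≫ F.map (differencePow.toSelf A n) =
      differencePow.toSelf Z n ≫ x
  | 0 => (congrArg (x ≫ ·) (F.map_id A)).trans
      ((Category.comp_id x).trans (Category.id_comp x).symm)
  | n + 1 =>
    (differencePowLift_succ_map_sub F x n _ _).trans
      ((by rw [differencePowLift_toSelf x n, difference.sub_comp, zero_comp, F.map_zero,
          comp_zero] :
        _ = difference.sub (differencePow.toSelf Z n) 0 ≫ x))

end ProtoadditiveDifferences

/-! ### Imaginary null-homotopies -/

section Homotopy

variable {C : Type u₁} [Category.{v₁} C] [HasZeroMorphisms C] [HasKernels C]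
  [HasBinaryCoproducts C]

/-- The condition on the `n`-th component `D^n(K_n) ⟶ Q_{n+1}` of an imaginary null-homotopy of a
chain morphism `θ : K ⟶ Q`. Writing `h_n` for that component, `τ` for the imaginary identity
`D^n(K_n) ⟶ K_n` and reading composites from left to right, it says that `h_0 d = θ_0` and that
`h_{n+1} d` is the difference of `τ θ_{n+1}` and `D^n(d) h_n`. Only the vanishing of the last term
on cycles matters, so `h_n` may be replaced by any other morphism. -/
def IsNullHomotopyComponent {K Q : ChainComplex C ℕ} (θ : K ⟶ Q) :
    ∀ n : ℕ, ((differencePow C n).obj (K.X n) ⟶ Q.X (n + 1)) → Prop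
  | 0, h => h ≫ Q.d 1 0 = θ.f 0
  | n + 1, h => ∃ h' : (differencePow C n).obj (K.X n) ⟶ Q.X (n + 1),
      h ≫ Q.d (n + 2) (n + 1) = difference.sub (differencePow.toSelf (K.X (n + 1)) n ≫ θ.f (n + 1))
        ((differencePow C n).map (K.d (n + 1) n) ≫ h')

/-- The compatibility which makes the next component of an imaginary null-homotopy exist. -/
lemma IsNullHomotopyComponent.map_d_comp {K Q : ChainComplex C ℕ} {θ : K ⟶ Q} :
    ∀ {n : ℕ} {h : (differencePow C n).obj (K.X n) ⟶ Q.X (n + 1)},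
      IsNullHomotopyComponent θ n h →
      (differencePow C n).map (K.d (n + 1) n) ≫ h ≫ Q.d (n + 1) n =
        (differencePow.toSelf (K.X (n + 1)) n ≫ θ.f (n + 1)) ≫ Q.d (n + 1) n
  | 0, h, hh => by
    have hh' : h ≫ Q.d 1 0 = θ.f 0 := hh
    have e₁ : (differencePow C 0).map (K.d 1 0) = K.d 1 0 := rfl
    have e₂ : differencePow.toSelf (K.X 1) 0 = 𝟙 (K.X 1) := rfl
    rw [hh', e₂]
    exact (θ.comm 1 0).symm.trans (congrArg (· ≫ Q.d 1 0) (Category.id_comp _).symm)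
  | n + 1, h, ⟨h', hh⟩ => by
    rw [hh]
    calc (difference C).map ((differencePow C n).map (K.d (n + 2) (n + 1))) ≫
          difference.sub (differencePow.toSelf (K.X (n + 1)) n ≫ θ.f (n + 1))
            ((differencePow C n).map (K.d (n + 1) n) ≫ h')
        = difference.sub (differencePow.toSelf (K.X (n + 2)) n ≫ K.d (n + 2) (n + 1) ≫ θ.f (n + 1))
            0 := by
          rw [difference.map_sub, ← Category.assoc, differencePow.map_toSelf, Category.assoc,
            ← Functor.map_comp_assoc, K.d_comp_d, Functor.map_zero, zero_comp]
      _ = (difference.sub (differencePow.toSelf (K.X (n + 2)) n) 0 ≫ θ.f (n + 2)) ≫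
            Q.d (n + 2) (n + 1) := by
          rw [Category.assoc, θ.comm, difference.sub_comp, zero_comp]

/-- A chain morphism from projectives to a resolution which lifts zero is null-homotopic in the
imaginary sense. -/
lemma exists_isNullHomotopyComponent [IsHomological C] (hP : ConditionP C) {K : ChainComplex C ℕ}
    (hK : ∀ n, IsRegularProjective (K.X n)) {Y : C} (R : ChainResolution Y)
    (θ : K ⟶ R.complex) (hθ : θ.f 0 ≫ R.aug = 0) :
    ∀ n : ℕ, ∃ h, IsNullHomotopyComponent θ n h
  | 0 => R.exact_zero.exists_lift (hK 0) _ hθ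
  | n + 1 => by
    obtain ⟨h', hh'⟩ := exists_isNullHomotopyComponent hP hK R θ hθ n
    obtain ⟨h, hh⟩ := (R.exact_succ n).exists_lift
      (isRegularProjective_differencePow hP (hK (n + 1)) (n + 1))
      (difference.sub (differencePow.toSelf (K.X (n + 1)) n ≫ θ.f (n + 1))
        ((differencePow C n).map (K.d (n + 1) n) ≫ h')) ((difference.sub_comp _ _ _).trans (by
          rw [Category.assoc _ h', hh'.map_d_comp, difference.sub_self]; rfl))
    exact ⟨h, h', hh⟩

variable {E : Type u₂} [Category.{v₂} E] [HasZeroMorphisms E] [HasKernels E]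
  [HasBinaryCoproducts E] (F : C ⥤ E) [IsProtoadditive F]

/-- On cycles, the component of an imaginary null-homotopy shows that `θ` is a boundary, as an
imaginary morphism. -/
lemma IsNullHomotopyComponent.cycle [HasZeroObject C] {K Q : ChainComplex C ℕ} {θ : K ⟶ Q} {Z : E} :
    ∀ {n : ℕ} {h : (differencePow C n).obj (K.X n) ⟶ Q.X (n + 1)},
      IsNullHomotopyComponent θ n h → ∀ (z : Z ⟶ F.obj (K.X n)),
      (∀ m, z ≫ F.map (K.d n m) = 0) →
      differencePowLift F z n ≫ F.map h ≫ F.map (Q.d (n + 1) n) =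
        differencePow.toSelf Z n ≫ z ≫ F.map (θ.f n)
  | 0, h, hh, z, _ => by
    rw [← F.map_comp, show h ≫ Q.d 1 0 = θ.f 0 from hh]
    exact (Category.id_comp _).symm
  | n + 1, h, ⟨h', hh⟩, z, hz => by
    rw [← F.map_comp, hh, differencePowLift_succ_map_sub, F.map_comp, F.map_comp,
      ← Category.assoc, ← Category.assoc, differencePowLift_toSelf, differencePowLift_map,
      hz, differencePowLift_zero, zero_comp]
    exact ((difference.sub_comp _ _ _).trans (by rw [zero_comp, Category.assoc])).symm

end Homotopy

/-! ### Existence of liftings -/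

section Lifting

variable {C : Type u₁} [Category.{v₁} C] [HasZeroMorphisms C] [HasKernels C]

/-- A morphism lifts to a chain morphism from a complex of projectives to a resolution. -/
lemma exists_lifting {K : ChainComplex C ℕ} (hK : ∀ n, IsRegularProjective (K.X n)) {X Y : C}
    (a : K.X 0 ⟶ X) (ha : K.d 1 0 ≫ a = 0) (R : ChainResolution Y) (x : X ⟶ Y) :
    ∃ φ : K ⟶ R.complex, φ.f 0 ≫ R.aug = a ≫ x := by
  obtain ⟨f₀, h₀⟩ := hK 0 R.aug (a ≫ x) R.regularEpi_aug
  obtain ⟨f₁, h₁⟩ := R.exact_zero.exists_lift (hK 1) (K.d 1 0 ≫ f₀)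
    (by rw [Category.assoc, h₀, reassoc_of% ha, zero_comp])
  have H (n : ℕ) (p : Σ' (f : K.X n ⟶ R.complex.X n) (f' : K.X (n + 1) ⟶ R.complex.X (n + 1)),
      f' ≫ R.complex.d (n + 1) n = K.d (n + 1) n ≫ f) :
      ∃ f'' : K.X (n + 2) ⟶ R.complex.X (n + 2),
        f'' ≫ R.complex.d (n + 2) (n + 1) = K.d (n + 2) (n + 1) ≫ p.2.1 :=
    (R.exact_succ n).exists_lift (hK _) _ (by
      rw [Category.assoc, p.2.2, K.d_comp_d_assoc, zero_comp])
  refine ⟨ChainComplex.mkHom _ _ f₀ f₁ h₁ fun n p => ⟨(H n p).choose, (H n p).choose_spec⟩, ?_⟩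
  rw [ChainComplex.mkHom_f_0, h₀]

lemma ChainResolution.d_aug {X : C} (R : ChainResolution X) : R.complex.d 1 0 ≫ R.aug = 0 :=
  R.exact_zero.1

lemma ChainResolution.exists_lifting {X Y : C} (R : ChainResolution X) (S : ChainResolution Y)
    (x : X ⟶ Y) : ∃ φ : R.complex ⟶ S.complex, φ.f 0 ≫ S.aug = R.aug ≫ x :=
  NonAdditive.exists_lifting R.projective R.aug R.d_aug S x

lemma ChainResolution.isProperComplex {X : C} (R : ChainResolution X) : IsProperComplex R.complex
  | 0 => R.exact_zero.isProper
  | n + 1 => (R.exact_succ n).isProper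

end Lifting

/-! ### Cycles and homology -/

section Cycles

variable {C : Type u₁} [Category.{v₁} C] [HasZeroMorphisms C]

variable [HasKernels C] [HasCokernels C]

/-- The object of cycles in degree `n`. -/
abbrev cyclesObj (n : ℕ) (K : ChainComplex C ℕ) : C :=
  ((HomologicalComplex.shortComplexFunctor C (ComplexShape.down ℕ) n).obj K).cycles

/-- The inclusion of the object of cycles. -/
def cyclesι (n : ℕ) (K : ChainComplex C ℕ) : cyclesObj n K ⟶ K.X n :=
  ((HomologicalComplex.shortComplexFunctor C (ComplexShape.down ℕ) n).obj K).iCycles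

lemma cyclesι_d (n : ℕ) (K : ChainComplex C ℕ) (m : ℕ) : cyclesι n K ≫ K.d n m = 0 := by
  by_cases h : (ComplexShape.down ℕ).Rel n m
  · obtain rfl := (ComplexShape.down ℕ).next_eq' h
    exact ShortComplex.iCycles_g _
  · rw [K.shape _ _ h, comp_zero]

/-- The projection of the object of cycles onto the homology. -/
def homologyπ (n : ℕ) (K : ChainComplex C ℕ) :
    cyclesObj n K ⟶ (homologyFunctor C n).obj K :=
  ShortComplex.leftHomologyπ ((HomologicalComplex.shortComplexFunctor C _ n).obj K)

instance (n : ℕ) (K : ChainComplex C ℕ) : Epi (homologyπ n K) :=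
  inferInstanceAs (Epi (ShortComplex.leftHomologyπ
    ((HomologicalComplex.shortComplexFunctor C _ n).obj K)))

/-- The action of a chain morphism on cycles. -/
def cyclesMap (n : ℕ) {K L : ChainComplex C ℕ} (f : K ⟶ L) :
    cyclesObj n K ⟶ cyclesObj n L :=
  ShortComplex.cyclesMap ((HomologicalComplex.shortComplexFunctor C (ComplexShape.down ℕ) n).map f)

lemma homologyπ_map (n : ℕ) {K L : ChainComplex C ℕ} (f : K ⟶ L) :
    homologyπ n K ≫ (homologyFunctor C n).map f = cyclesMap n f ≫ homologyπ n L :=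
  ShortComplex.leftHomologyπ_naturality _

lemma cyclesMap_ι (n : ℕ) {K L : ChainComplex C ℕ} (f : K ⟶ L) :
    cyclesMap n f ≫ cyclesι n L = cyclesι n K ≫ f.f n :=
  ShortComplex.cyclesMap_i _

instance (n : ℕ) (K : ChainComplex C ℕ) : Mono (cyclesι n K) :=
  inferInstanceAs (Mono (ShortComplex.iCycles
    ((HomologicalComplex.shortComplexFunctor C _ n).obj K)))

/-- A cycle which is a boundary vanishes in the homology. -/
lemma comp_homologyπ_eq_zero (n : ℕ) (K : ChainComplex C ℕ) {W : C} (t : W ⟶ cyclesObj n K)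
    (y : W ⟶ K.X (n + 1)) (h : t ≫ cyclesι n K = y ≫ K.d (n + 1) n) : t ≫ homologyπ n K = 0 := by
  -- The short complex in degree `n` is defined with `prev n`, which is only propositionally equal
  -- to `n + 1`.
  obtain ⟨m, hm, y', hy'⟩ : ∃ m, ∃ hm : (ComplexShape.down ℕ).prev n = m, ∃ y' : W ⟶ K.X m,
    t ≫ cyclesι n K = y' ≫ K.d m n := ⟨n + 1, by simp, y, h⟩
  subst hm
  let b : K.X ((ComplexShape.down ℕ).prev n) ⟶ cyclesObj n K :=
    ShortComplex.toCycles ((HomologicalComplex.shortComplexFunctor C _ n).obj K)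
  have hb : b ≫ cyclesι n K = K.d _ n := ShortComplex.toCycles_i _
  have hb' : b ≫ homologyπ n K = 0 := ShortComplex.toCycles_comp_leftHomologyπ _
  have : t = y' ≫ b := by rw [← cancel_mono (cyclesι n K), hy', Category.assoc, hb]
  rw [this, Category.assoc, hb', comp_zero]

end Cycles

/-! ### Independence of the lifting and of the resolution -/

section Comparison

variable {C : Type u₁} [Category.{v₁} C] [HasZeroMorphisms C] [IsHomological C]
  [HasBinaryCoproducts C]

/-- The degreewise difference of two chain morphisms. -/
def complexSub {K Q : ChainComplex C ℕ} (φ ψ : K ⟶ Q) :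
    (mapComplex (difference C)).obj K ⟶ Q where
  f n := difference.sub (φ.f n) (ψ.f n)
  comm' i j _ := by
    refine (difference.sub_comp _ _ _).trans (Eq.trans ?_ (difference.map_sub _ _ _).symm)
    rw [φ.comm, ψ.comm]

variable {E : Type u₂} [Category.{v₂} E] [HasZeroMorphisms E] [IsHomological E]
  [HasBinaryCoproducts E] [HasCokernels E] (F : C ⥤ E) [IsProtoadditive F]

/-- Two chain morphisms into a resolution which agree on the augmentation have the same image under
`H_n(F(-))`. -/
theorem homology_map_eq (hP : ConditionP C) {K : ChainComplex C ℕ}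
    (hK : ∀ n, IsRegularProjective (K.X n)) {Y : C} (R : ChainResolution Y)
    (φ ψ : K ⟶ R.complex) (h : φ.f 0 ≫ R.aug = ψ.f 0 ≫ R.aug) (n : ℕ) :
    (homologyFunctor E n).map ((mapComplex F).map φ) =
      (homologyFunctor E n).map ((mapComplex F).map ψ) := by
  obtain ⟨s, hs⟩ := exists_isNullHomotopyComponent hP
    (K := (mapComplex (difference C)).obj K) (fun m => isRegularProjective_difference hP (hK m)) R
    (complexSub φ ψ) (by
      change difference.sub (φ.f 0) (ψ.f 0) ≫ R.aug = 0
      rw [difference.sub_comp, h, difference.sub_self]) n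
  -- The difference of two cycles, as an imaginary morphism, is again a cycle `z`, and `φ - ψ` is
  -- defined on it. Being a boundary may be tested after the epimorphism `D^n(D(Z)) ⟶ D(Z)`.
  let Z := cyclesObj n ((mapComplex F).obj K)
  let i : Z ⟶ F.obj (K.X n) := cyclesι n ((mapComplex F).obj K)
  have hi (m : ℕ) : i ≫ F.map (K.d n m) = 0 := cyclesι_d n ((mapComplex F).obj K) m
  let z : (difference E).obj Z ⟶ F.obj ((difference C).obj (K.X n)) :=
    (difference E).map i ≫ differenceComparison F _
  have hz (m : ℕ) : z ≫ F.map ((difference C).map (K.d n m)) = 0 := by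
    rw [Category.assoc, ← differenceComparison_naturality, ← Functor.map_comp_assoc, hi,
      Functor.map_zero, zero_comp]
  have key := hs.cycle F z hz
  rw [← cancel_epi (homologyπ n _), homologyπ_map, homologyπ_map]
  refine difference.eq_of_sub_eq_zero ?_
  have := differencePow.epi_toSelf ((difference E).obj Z) n
  rw [← difference.sub_comp, ← cancel_epi (differencePow.toSelf ((difference E).obj Z) n),
    comp_zero, ← Category.assoc]
  refine comp_homologyπ_eq_zero n _ _ (differencePowLift F z n ≫ F.map s) ?_
  rw [Category.assoc, difference.sub_comp, cyclesMap_ι, cyclesMap_ι]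
  refine Eq.trans ?_ (key.symm.trans (Category.assoc _ _ _).symm)
  congr 1
  change difference.sub (i ≫ F.map (φ.f n)) (i ≫ F.map (ψ.f n)) =
    ((difference E).map i ≫ differenceComparison F _) ≫ F.map (difference.sub (φ.f n) (ψ.f n))
  rw [Category.assoc, differenceComparison_map_sub, difference.map_sub]

/-- The homology of `F` of a resolution does not depend on the resolution. -/
lemma exists_homologyIso (hP : ConditionP C) {X : C} (R S : ChainResolution X) (n : ℕ) :
    ∃ i : (homologyFunctor E n).obj ((mapComplex F).obj R.complex) ≅
        (homologyFunctor E n).obj ((mapComplex F).obj S.complex),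
      ∀ φ : R.complex ⟶ S.complex, φ.f 0 ≫ S.aug = R.aug →
        (homologyFunctor E n).map ((mapComplex F).map φ) = i.hom := by
  obtain ⟨φ, hφ⟩ := R.exists_lifting S (𝟙 X)
  obtain ⟨ψ, hψ⟩ := S.exists_lifting R (𝟙 X)
  rw [Category.comp_id] at hφ hψ
  refine ⟨⟨(homologyFunctor E n).map ((mapComplex F).map φ),
    (homologyFunctor E n).map ((mapComplex F).map ψ), ?_, ?_⟩, fun φ' hφ' =>
      homology_map_eq F hP R.projective S φ' φ (hφ'.trans hφ.symm) n⟩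
  · rw [← Functor.map_comp, ← Functor.map_comp, homology_map_eq F hP R.projective R (φ ≫ ψ) (𝟙 _)
      (by simp [hφ, hψ]), CategoryTheory.Functor.map_id,
      CategoryTheory.Functor.map_id]
  · rw [← Functor.map_comp, ← Functor.map_comp, homology_map_eq F hP S.projective S (ψ ≫ φ) (𝟙 _)
      (by simp [hφ, hψ]), CategoryTheory.Functor.map_id,
      CategoryTheory.Functor.map_id]

end Comparison

/-! ### Moore complexes as iterated kernels of split epimorphisms -/

section PartialMoore

variable {C : Type u₁} [Category.{v₁} C] [HasZeroMorphisms C]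

/-- The composites of `x : W ⟶ A_n` with the faces `∂_l`, `l < r`, are zero. There are no faces to
consider when `n = 0`. -/
def VanishesBelow (A : SimplicialObject C) {W : C} : ∀ n : ℕ, ℕ → (W ⟶ level A n) → Prop
  | 0, _, _ => True
  | n + 1, r, x => ∀ l : Fin (n + 2), l.val < r → x ≫ A.δ l = 0

lemma VanishesBelow.comp {A : SimplicialObject C} {W' W : C} {n r : ℕ} {x : W ⟶ level A n}
    (h : VanishesBelow A n r x) (y : W' ⟶ W) : VanishesBelow A n r (y ≫ x) := by
  cases n with
  | zero => trivial
  | succ n => intro l hl; rw [Category.assoc, h l hl, comp_zero]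

lemma VanishesBelow.comp_δ {A : SimplicialObject C} {W : C} {n r : ℕ} (hr : r ≤ n)
    {x : W ⟶ level A (n + 1)} (h : VanishesBelow A (n + 1) r x) :
    VanishesBelow A n r (x ≫ A.δ ⟨r, by omega⟩) := by
  cases n with
  | zero => trivial
  | succ n =>
    intro l hl
    have e := A.δ_comp_δ (i := l) (j := ⟨r - 1, by omega⟩) (by rw [Fin.le_def]; simp; omega)
    have e' : (⟨r - 1, by omega⟩ : Fin (n + 2)).succ = ⟨r, by omega⟩ := by ext; simp; omega
    rw [e'] at e
    rw [Category.assoc, e, ← Category.assoc, h l.castSucc hl, zero_comp]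

lemma VanishesBelow.comp_σ {A : SimplicialObject C} {W : C} {n r : ℕ} (hr : r ≤ n)
    {x : W ⟶ level A n} (h : VanishesBelow A n r x) :
    VanishesBelow A (n + 1) r (x ≫ A.σ ⟨r, by omega⟩) := by
  intro l hl
  cases n with
  | zero => omega
  | succ n =>
    have e := A.δ_comp_σ_of_le (i := (⟨l, by omega⟩ : Fin (n + 2)))
      (j := (⟨r - 1, by omega⟩ : Fin (n + 1)))
      (by rw [Fin.le_def]; simp; omega)
    have e' : (⟨r - 1, by omega⟩ : Fin (n + 1)).succ = ⟨r, by omega⟩ := by ext; simp; omega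
    rw [e'] at e
    rw [Category.assoc]
    refine (congrArg (x ≫ ·) e).trans ?_
    rw [← Category.assoc, h ⟨l, by omega⟩ hl, zero_comp]

/-- The morphism `k` is the intersection of the kernels of the faces `∂_l : A_n ⟶ A_{n-1}`, for
`l < r`. -/
structure IsPartialMoore (A : SimplicialObject C) (n r : ℕ) {K : C} (k : K ⟶ level A n) :
    Prop where
  mono : Mono k
  vanishes : VanishesBelow A n r k
  exists_lift : ∀ {W : C} (t : W ⟶ level A n), VanishesBelow A n r t → ∃ l : W ⟶ K, l ≫ k = t

lemma isPartialMoore_id (A : SimplicialObject C) (n : ℕ) :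
    IsPartialMoore A n 0 (𝟙 (level A n)) where
  mono := inferInstance
  vanishes := by
    cases n with
    | zero => trivial
    | succ n => intro l hl; omega
  exists_lift t _ := ⟨t, Category.comp_id t⟩

/-- The face `∂_r` restricts to a morphism between partial Moore objects, split by the restriction
of the degeneracy `σ_r`. -/
lemma IsPartialMoore.isSplitEpi {A : SimplicialObject C} {n r : ℕ} (hr : r ≤ n) {K L : C}
    {k : K ⟶ level A (n + 1)} {l : L ⟶ level A n} (hk : IsPartialMoore A (n + 1) r k)
    (hl : IsPartialMoore A n r l) {d : K ⟶ L} (hd : d ≫ l = k ≫ A.δ ⟨r, by omega⟩) :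
    IsSplitEpi d := by
  obtain ⟨s, hs⟩ := hk.exists_lift _ (hl.vanishes.comp_σ hr)
  have := hl.mono
  refine ⟨⟨⟨s, ?_⟩⟩⟩
  have e := A.δ_comp_σ_self (i := (⟨r, by omega⟩ : Fin (n + 1)))
  rw [← cancel_mono l, Category.assoc, hd, ← Category.assoc, hs, Category.assoc, Category.id_comp]
  exact (congrArg (l ≫ ·) e).trans (Category.comp_id _)

/-- Intersecting with the kernel of one more face amounts to a kernel of the restriction of that
face. -/
lemma IsPartialMoore.step {A : SimplicialObject C} {n r : ℕ} (hr : r ≤ n) {K L M : C}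
    {k : K ⟶ level A (n + 1)} {l : L ⟶ level A n} (hk : IsPartialMoore A (n + 1) r k)
    (hl : IsPartialMoore A n r l) {d : K ⟶ L} (hd : d ≫ l = k ≫ A.δ ⟨r, by omega⟩)
    {m : M ⟶ K} (hm : IsKernelOf m d) : IsPartialMoore A (n + 1) (r + 1) (m ≫ k) := by
  have := hl.mono
  have := hk.mono
  have := hm.mono
  refine ⟨mono_comp _ _, fun i hi => ?_, fun {W} t ht => ?_⟩
  · obtain h | h : i.val < r ∨ i = ⟨r, by omega⟩ := by rw [Fin.ext_iff]; simp; omega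
    · exact (hk.vanishes.comp m) i h
    · rw [h, Category.assoc, ← hd, ← Category.assoc, hm.zero, zero_comp]
  · obtain ⟨u, hu⟩ := hk.exists_lift t fun i hi => ht i (by omega)
    obtain ⟨v, hv⟩ := hm.exists_lift u (by
      rw [← cancel_mono l, Category.assoc, hd, ← Category.assoc, hu, zero_comp]
      exact ht _ (by simp))
    exact ⟨v, by rw [reassoc_of% hv, hu]⟩

lemma IsPartialMoore.exists_iso {A : SimplicialObject C} {n r : ℕ} {K L : C}
    {k : K ⟶ level A n} {l : L ⟶ level A n} (hk : IsPartialMoore A n r k)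
    (hl : IsPartialMoore A n r l) : ∃ e : K ≅ L, e.hom ≫ l = k := by
  obtain ⟨a, ha⟩ := hl.exists_lift k hk.vanishes
  obtain ⟨b, hb⟩ := hk.exists_lift l hl.vanishes
  have := hl.mono
  have := hk.mono
  exact ⟨⟨a, b, by rw [← cancel_mono k, Category.assoc, hb, ha, Category.id_comp],
    by rw [← cancel_mono l, Category.assoc, ha, hb, Category.id_comp]⟩, ha⟩

lemma IsPartialMoore.of_iso {A : SimplicialObject C} {n r : ℕ} {K L : C}
    {k : K ⟶ level A n} {l : L ⟶ level A n} (hk : IsPartialMoore A n r k)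
    (e : K ≅ L) (he : e.hom ≫ l = k) : IsPartialMoore A n r l := by
  obtain rfl : l = e.inv ≫ k := by rw [← he, Iso.inv_hom_id_assoc]
  have := hk.mono
  refine ⟨mono_comp _ _, hk.vanishes.comp _, fun t ht => ?_⟩
  obtain ⟨a, ha⟩ := hk.exists_lift t ht
  exact ⟨a ≫ e.hom, by simpa using ha⟩

lemma isRegularProjective_of_iso {C : Type u₁} [Category.{v₁} C] {P Q : C} (e : P ≅ Q)
    (hP : IsRegularProjective P) :
    IsRegularProjective Q := fun p f hp => by
  obtain ⟨g, hg⟩ := hP p (e.hom ≫ f) hp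
  exact ⟨e.inv ≫ g, by rw [Category.assoc, hg, Iso.inv_hom_id_assoc]⟩

/-- Partial Moore objects are iterated kernels of split epimorphisms, and hence preserved by
protoadditive functors; by Condition (P), they inherit projectivity. -/
lemma exists_isPartialMoore [HasZeroObject C] [HasKernels C] {E : Type u₂} [Category.{v₂} E]
    [HasZeroMorphisms E] (F : C ⥤ E) [IsProtoadditive F] (A : SimplicialObject C) (r : ℕ) :
    ∀ n : ℕ, r ≤ n → ∃ (K : C) (k : K ⟶ level A n), IsPartialMoore A n r k ∧
      IsPartialMoore ((mapSimplicial F).obj A) n r (F.map k) ∧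
      (ConditionP C → (∀ m, IsRegularProjective (level A m)) → IsRegularProjective K) := by
  induction r with
  | zero =>
    intro n _
    refine ⟨_, 𝟙 _, isPartialMoore_id A n, ?_, fun _ h => h n⟩
    rw [F.map_id]
    exact isPartialMoore_id _ n
  | succ r ih =>
    intro n hn
    obtain ⟨n, rfl⟩ : ∃ m, n = m + 1 := ⟨n - 1, by omega⟩
    obtain ⟨K, k, hk, hFk, hPk⟩ := ih (n + 1) (by omega)
    obtain ⟨L, l, hl, hFl, -⟩ := ih n (by omega)
    have hr : r ≤ n := by omega
    obtain ⟨d, hd⟩ := hl.exists_lift _ (hk.vanishes.comp_δ hr)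
    have hs := hk.isSplitEpi hr hl hd
    have hm := isKernelOf_kernel d
    refine ⟨kernel d, kernel.ι d ≫ k, hk.step hr hl hd hm, ?_,
      fun hP h => hP _ _ hs hm (hPk hP h)⟩
    rw [F.map_comp]
    refine hFk.step hr hFl (d := F.map d) ?_ (IsProtoadditive.map_kernel _ _ hs hm)
    exact (F.map_comp _ _).symm.trans ((congrArg F.map hd).trans (F.map_comp _ _))

variable [HasFiniteLimits C]

lemma Moore.isPartialMoore (A : SimplicialObject C) : ∀ n : ℕ, IsPartialMoore A n n (Moore.ι A n)
  | 0 => isPartialMoore_id A 0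
  | n + 1 => ⟨inferInstance, fun l hl => Moore.ι_δ A n ⟨l, hl⟩, fun t ht =>
    ⟨Moore.lift A t fun l => ht l.castSucc l.2, Moore.lift_ι A t _⟩⟩

lemma Moore.isRegularProjective_obj [HasZeroObject C] (hP : ConditionP C) {A : SimplicialObject C}
    (hA : ∀ n, IsRegularProjective (level A n)) (n : ℕ) :
    IsRegularProjective (Moore.obj A n) := by
  have : IsProtoadditive (𝟭 C) := ⟨fun _ _ _ h => h⟩
  obtain ⟨K, k, hk, -, hK⟩ := exists_isPartialMoore (𝟭 C) A n n le_rfl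
  obtain ⟨e, -⟩ := hk.exists_iso (Moore.isPartialMoore A n)
  intro X Y p f hp
  exact isRegularProjective_of_iso e (hK hP hA) p f hp

variable [HasZeroObject C] {E : Type u₂} [Category.{v₂} E] [HasZeroMorphisms E] [HasFiniteLimits E]
  (F : C ⥤ E) [IsProtoadditive F]

/-- Protoadditive functors commute with the Moore functor. -/
lemma isIso_mooreComparison (A : SimplicialObject C) : IsIso (mooreComparison F A) := by
  have (n : ℕ) : IsIso ((mooreComparison F A).f n) := by
    obtain ⟨K, k, hk, hFk, -⟩ := exists_isPartialMoore F A n n le_rfl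
    obtain ⟨e, he⟩ := hk.exists_iso (Moore.isPartialMoore A n)
    have h : IsPartialMoore ((mapSimplicial F).obj A) n n (F.map (Moore.ι A n)) :=
      hFk.of_iso (F.mapIso e) ((F.map_comp _ _).symm.trans (congrArg F.map he))
    obtain ⟨i, hi⟩ := h.exists_iso (Moore.isPartialMoore _ n)
    have : mooreComparisonApp F A n = i.hom := by
      rw [← cancel_mono (Moore.ι _ n), mooreComparisonApp_ι, hi]
    change IsIso (mooreComparisonApp F A n)
    rw [this]
    infer_instance
  exact HomologicalComplex.Hom.isIso_of_components _

/-- The comparison `F(N(A)) ⟶ N(F(A))` is an isomorphism. -/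
def mooreComparisonIso (A : SimplicialObject C) :
    (mapComplex F).obj ((moore C).obj A) ≅ (moore E).obj ((mapSimplicial F).obj A) :=
  @asIso _ _ _ _ (mooreComparison F A) (isIso_mooreComparison F A)

lemma mooreComparison_naturality {A B : SimplicialObject C} (f : A ⟶ B) :
    (mapComplex F).map ((moore C).map f) ≫ mooreComparison F B =
      mooreComparison F A ≫ (moore E).map ((mapSimplicial F).map f) := by
  ext n
  change F.map (Moore.map f n) ≫ mooreComparisonApp F B n =
    mooreComparisonApp F A n ≫ Moore.map ((mapSimplicial F).map f) n
  rw [← cancel_mono (Moore.ι _ n), Category.assoc, Category.assoc, mooreComparisonApp_ι,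
    Moore.map_ι, ← Category.assoc, mooreComparisonApp_ι]
  exact (F.map_comp _ _).symm.trans ((congrArg F.map (Moore.map_ι f n)).trans (F.map_comp _ _))

/-- The Moore complex of a simplicial resolution is a chain resolution. -/
def SimplicialResolution.toChainResolution (hP : ConditionP C) {X : C}
    (S : SimplicialResolution X) : ChainResolution X where
  complex := (moore C).obj S.obj
  aug := Moore.ι S.obj 0 ≫ S.aug
  projective := Moore.isRegularProjective_obj hP S.projective
  regularEpi_aug := (Category.id_comp S.aug).symm ▸ S.regularEpi_aug
  exact_zero := S.exact_zero
  exact_succ := S.exact_succ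

end PartialMoore

/-! ### Proper morphisms and isomorphisms -/

section Proper

variable {C : Type u₁} [Category.{v₁} C] [HasZeroMorphisms C]

lemma IsProper.of_iso {X Y X' Y' : C} {f : X ⟶ Y} (h : IsProper f) (a : X ≅ X')
    (b : Y ≅ Y') : IsProper (a.inv ≫ f ≫ b.hom) := by
  obtain ⟨I, e, m, he, ⟨hm⟩, rfl⟩ := h
  have : Mono m := inferInstance
  have w : (m ≫ b.hom) ≫ b.inv ≫ hm.g = 0 := by simp [hm.w]
  refine ⟨I, a.inv ≫ e, m ≫ b.hom, ?_, ⟨⟨hm.Z, b.inv ≫ hm.g, w,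
    KernelFork.IsLimit.ofι' _ w fun {W} t ht => ?_⟩⟩, by simp⟩
  · exact ⟨⟨RegularEpi.ofArrowIso (f := e) (g := a.inv ≫ e) (Arrow.isoMk a (Iso.refl I))
      (IsRegularEpi.getStruct e)⟩⟩
  · obtain ⟨l, hl⟩ := NormalMono.lift' m (t ≫ b.inv) (by rw [Category.assoc, ht])
    exact ⟨l, by rw [reassoc_of% hl, Iso.inv_hom_id, Category.comp_id]⟩

lemma IsProperComplex.of_iso {K L : ChainComplex C ℕ} (h : IsProperComplex K) (e : K ≅ L) :
    IsProperComplex L := fun n => by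
  have := (h n).of_iso (HomologicalComplex.Hom.isoApp e (n + 1)) (HomologicalComplex.Hom.isoApp e n)
  simpa using this

end Proper

/-! ### The Kan condition in homological categories -/

section Kan

variable {C : Type u₁} [Category.{v₁} C] [HasZeroMorphisms C] [IsHomological C]

attribute [local simp] prod.lift_fst prod.lift_snd pullback.lift_fst pullback.lift_snd
  prod.lift_fst_assoc prod.lift_snd_assoc pullback.lift_fst_assoc pullback.lift_snd_assoc

/-- In a homological category, `a` can be modified to have a prescribed image `c` under the split
epimorphism `p` without changing its image under `f`, provided that the obvious compatibility holds
and the section of `p` is compatible with `f`. -/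
lemma exists_modification {A B X D P : C} (hP : IsRegularProjective P) {p : A ⟶ X} {s : X ⟶ A}
    (hs : s ≫ p = 𝟙 X) {f : A ⟶ B} {g : X ⟶ D} {q : B ⟶ D} {t : D ⟶ B} (hf : f ≫ q = p ≫ g)
    (ht : s ≫ f = g ≫ t) (a : P ⟶ A) (c : P ⟶ X) (h : a ≫ p ≫ g = c ≫ g) :
    ∃ a' : P ⟶ A, a' ≫ f = a ≫ f ∧ a' ≫ p = c := by
  -- The pairs `(a, c)` for which an `a'` exists form the image of `r`; they contain the kernel and
  -- the section of a split epimorphism, hence they are all the compatible pairs.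
  let r : pullback f f ⟶ pullback (p ≫ g) g := pullback.lift (pullback.fst f f)
    (pullback.snd f f ≫ p) (by
      rw [← hf, ← Category.assoc, pullback.condition, Category.assoc, hf, Category.assoc])
  let fac := Regular.strongEpiMonoFactorisation r
  let π : pullback (p ≫ g) g ⟶ pullback g g := pullback.lift (pullback.fst _ _ ≫ p)
    (pullback.snd _ _) (by rw [Category.assoc, pullback.condition])
  let σ : pullback g g ⟶ pullback (p ≫ g) g := pullback.lift (pullback.fst g g ≫ s)
    (pullback.snd g g) (by rw [Category.assoc, reassoc_of% hs, pullback.condition])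
  let κ : kernel p ⟶ pullback (p ≫ g) g := pullback.lift (kernel.ι p) 0 (by simp)
  have hσ : σ ≫ π = 𝟙 _ := by ext <;> simp [σ, π, hs]
  have hκι : κ ≫ pullback.fst (p ≫ g) g = kernel.ι p := pullback.lift_fst _ _ _
  have : Mono κ := mono_of_mono_fac hκι
  have hκ : IsKernelOf κ π := by
    refine isKernelOf_of_exists_lift (by ext <;> simp [κ, π]) fun t ht => ?_
    have h₁ : t ≫ pullback.fst _ _ ≫ p = 0 := by simpa [π] using congr($ht ≫ pullback.fst g g)
    have h₂ : t ≫ pullback.snd _ _ = 0 := by simpa [π] using congr($ht ≫ pullback.snd g g)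
    exact ⟨kernel.lift p (t ≫ pullback.fst _ _) (by rw [Category.assoc, h₁]), by
      ext <;> simp [κ, h₂]⟩
  let κ' : kernel p ⟶ pullback f f := pullback.lift (kernel.ι p) (kernel.ι p) rfl
  let σ' : pullback g g ⟶ pullback f f := pullback.lift (pullback.fst g g ≫ s)
    (pullback.snd g g ≫ s) (by
      rw [Category.assoc, Category.assoc, ht, ← Category.assoc, pullback.condition, Category.assoc])
  have hκ' : (κ' ≫ fac.e) ≫ fac.m = κ := by
    rw [Category.assoc, fac.fac]
    ext <;> simp [κ', κ, r]
  have hσ' : (σ' ≫ fac.e) ≫ fac.m = σ := by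
    rw [Category.assoc, fac.fac]
    ext <;> simp [σ', σ, r, hs]
  have : IsIso fac.m := IsHomological.protomodular κ π σ fac.m _ _ hσ hκ inferInstance hκ' hσ'
  let z : P ⟶ pullback (p ≫ g) g := pullback.lift a c h
  obtain ⟨y, hy⟩ := hP fac.e (z ≫ inv fac.m) inferInstance
  have hyr : y ≫ r = z := by
    rw [← fac.fac, reassoc_of% hy, IsIso.inv_hom_id, Category.comp_id]
  have h₁ : y ≫ pullback.fst f f = a := by
    simpa [r, z] using congr($hyr ≫ pullback.fst _ _)
  have h₂ : y ≫ pullback.snd f f ≫ p = c := by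
    simpa [r, z] using congr($hyr ≫ pullback.snd _ _)
  exact ⟨y ≫ pullback.snd f f, by rw [Category.assoc, ← pullback.condition, reassoc_of% h₁],
    by rw [Category.assoc, h₂]⟩

/-- The form of `exists_modification` for finite families. -/
lemma exists_modification_family {A X P : C} (hP : IsRegularProjective P) {p : A ⟶ X} {s : X ⟶ A}
    (hs : s ≫ p = 𝟙 X) {I : Type} [Finite I] {B D : I → C} {f : ∀ i, A ⟶ B i} {g : ∀ i, X ⟶ D i}
    {q : ∀ i, B i ⟶ D i} {t : ∀ i, D i ⟶ B i} (hf : ∀ i, f i ≫ q i = p ≫ g i)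
    (ht : ∀ i, s ≫ f i = g i ≫ t i) (a : P ⟶ A) (c : P ⟶ X) (h : ∀ i, a ≫ p ≫ g i = c ≫ g i) :
    ∃ a' : P ⟶ A, (∀ i, a' ≫ f i = a ≫ f i) ∧ a' ≫ p = c := by
  obtain ⟨a', h₁, h₂⟩ := exists_modification hP hs (f := Pi.lift f) (g := Pi.lift g)
    (q := Limits.Pi.map q) (t := Limits.Pi.map t)
    (by apply Limits.Pi.hom_ext; intro i; simp [hf])
    (by apply Limits.Pi.hom_ext; intro i; simp [ht]) a c
    (by apply Limits.Pi.hom_ext; intro i; simp [h])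
  exact ⟨a', fun i => by simpa using congr($h₁ ≫ Pi.π _ i), h₂⟩

/-- Simplicial objects in a homological category satisfy the Kan condition: horns with missing
face `0` have fillers. -/
lemma exists_filler (A : SimplicialObject C) {P : C} (hP : IsRegularProjective P) (n : ℕ)
    (x : Fin (n + 2) → (P ⟶ level A (n + 1)))
    (hx : ∀ i j : Fin (n + 1), i ≤ j → x j.succ ≫ A.δ i.succ = x i.castSucc ≫ A.δ j.succ) :
    ∃ w : P ⟶ level A (n + 2), ∀ j, w ≫ A.δ j.succ = x j := by
  -- The faces are corrected one after the other, starting with the last one.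
  suffices H : ∀ t : ℕ, ∃ w : P ⟶ level A (n + 2), ∀ j : Fin (n + 2), n + 2 ≤ j.val + t →
      w ≫ A.δ j.succ = x j by
    obtain ⟨w, hw⟩ := H (n + 2)
    exact ⟨w, fun j => hw j (by omega)⟩
  intro t
  induction t with
  | zero => exact ⟨0, fun j hj => by omega⟩
  | succ t ih =>
    obtain ⟨w, hw⟩ := ih
    by_cases htn : n + 2 ≤ t
    · exact ⟨w, fun j _ => hw j (by omega)⟩
    let j₀ : Fin (n + 2) := ⟨n + 1 - t, by omega⟩
    let I := {l : Fin (n + 1) // n + 1 - t ≤ l.val}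
    let j₁ (l : I) : Fin (n + 1) := ⟨n + 1 - t, by have := l.1.2; have := l.2; omega⟩
    have hle (l : I) : j₁ l ≤ l.1 := l.2
    have hface (l : I) : A.δ l.1.succ.succ ≫ A.δ (j₁ l).succ = A.δ j₀.succ ≫ A.δ l.1.succ :=
      A.δ_comp_δ (i := (j₁ l).succ) (j := l.1.succ) (Fin.succ_le_succ_iff.2 (hle l))
    have hdeg (l : I) : A.σ j₀ ≫ A.δ l.1.succ.succ = A.δ l.1.succ ≫ A.σ (j₁ l) :=
      A.δ_comp_σ_of_gt (i := l.1.succ) (j := j₁ l) (Fin.castSucc_lt_succ_iff.2 (hle l))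
    obtain ⟨w', h₁, h₂⟩ := exists_modification_family hP (A.δ_comp_σ_succ (i := j₀)) hface hdeg
      w (x j₀) fun l => by
        rw [← hface, ← Category.assoc, hw l.1.succ (by have := l.2; simp; omega)]
        exact hx _ _ (hle l)
    refine ⟨w', fun j hj => ?_⟩
    obtain rfl | hj' : j = j₀ ∨ n + 2 ≤ j.val + t := by rw [Fin.ext_iff]; simp [j₀]; omega
    · exact h₂
    · obtain ⟨l, rfl⟩ := Fin.exists_succ_eq_of_ne_zero (x := j) (by
        rintro rfl; simp at hj'; omega)
      rw [← hw _ hj']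
      exact h₁ ⟨l, by simp at hj'; omega⟩

/-- If the members of a family `y` lift along `∂_0` to a horn, then they are the faces of
a simplex. -/
lemma exists_of_horn (A : SimplicialObject C) {P : C} (hP : IsRegularProjective P) (n : ℕ)
    (x : Fin (n + 2) → (P ⟶ level A (n + 1))) (y : Fin (n + 2) → (P ⟶ level A n))
    (hxy : ∀ j, x j ≫ A.δ 0 = y j)
    (hx : ∀ i j : Fin (n + 1), i ≤ j → x j.succ ≫ A.δ i.succ = x i.castSucc ≫ A.δ j.succ) :
    ∃ v : P ⟶ level A (n + 1), ∀ j, v ≫ A.δ j = y j := by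
  obtain ⟨w, hw⟩ := exists_filler A hP n x hx
  refine ⟨w ≫ A.δ 0, fun j => ?_⟩
  have e := A.δ_comp_δ (i := 0) (j := j) (Fin.zero_le j)
  rw [Fin.castSucc_zero] at e
  rw [Category.assoc, ← e, ← Category.assoc, hw, hxy]

lemma isRegularEpi_of_comp {X Y Z : C} (f : X ⟶ Y) (g : Y ⟶ Z) (h : IsRegularEpi (f ≫ g)) :
    IsRegularEpi g := by
  have : StrongEpi g := strongEpi_of_strongEpi f g
  have : ExtremalEpi g := inferInstance
  infer_instance

/-- A pair is exact as soon as one regular epimorphism onto the kernel lifts. -/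
lemma isExactPair_of_lift {A B D P : C} {f : A ⟶ B} {g : B ⟶ D} (hw : f ≫ g = 0)
    (p : P ⟶ kernel g) (hp : IsRegularEpi p) (h : ∃ y : P ⟶ A, y ≫ f = p ≫ kernel.ι g) :
    IsExactPair f g := by
  obtain ⟨y, hy⟩ := h
  have e : y ≫ kernel.lift g f hw = p := by
    rw [← cancel_mono (kernel.ι g), Category.assoc, kernel.lift_ι, hy]
  exact ⟨hw, isRegularEpi_of_comp y _ (e.symm ▸ hp)⟩

end Kan

/-! ### Contractible simplicial objects -/

section Contraction

variable {C : Type u₁} [Category.{v₁} C] [HasZeroMorphisms C] [IsHomological C]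

/-- A contraction of the augmented simplicial set `Hom(P, A) ⟶ Hom(P, X)`: an extra degeneracy with
`∂_0 s = 1` and `∂_{i+1} s = s ∂_i`. It need not preserve zero morphisms, and it need not be induced
by morphisms of `C`. -/
structure ElementwiseContraction {X : C} (A : SimplicialObject C) (aug : level A 0 ⟶ X)
    (P : C) where
  /-- the contraction in degree `-1` -/
  base : (P ⟶ X) → (P ⟶ level A 0)
  /-- the contraction in nonnegative degrees -/
  map : ∀ n : ℕ, (P ⟶ level A n) → (P ⟶ level A (n + 1))
  base_aug : ∀ x, base x ≫ aug = x
  map_δ_zero : ∀ n x, map n x ≫ A.δ 0 = x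
  map_zero_δ : ∀ x, map 0 x ≫ A.δ 1 = base (x ≫ aug)
  map_succ_δ : ∀ n x i, map (n + 1) x ≫ A.δ (Fin.succ i) = map n (x ≫ A.δ i)

namespace ElementwiseContraction

variable {X : C} {A : SimplicialObject C} {aug : level A 0 ⟶ X} {P : C}

/-- In degree `0`, a pair of elements over zero bounds a `1`-simplex. -/
lemma exists_faces_zero (s : ElementwiseContraction A aug P) (hP : IsRegularProjective P)
    (y : Fin 2 → (P ⟶ level A 0)) (hy : ∀ i, y i ≫ aug = 0) :
    ∃ v : P ⟶ level A 1, ∀ j, v ≫ A.δ j = y j :=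
  exists_of_horn A hP 0 (fun j => s.map 0 (y j)) y (fun j => s.map_δ_zero 0 _) (fun i j _ => by
    rw [Subsingleton.elim (α := Fin 1) i 0, Subsingleton.elim (α := Fin 1) j 0]
    change s.map 0 _ ≫ A.δ 1 = s.map 0 _ ≫ A.δ 1
    rw [s.map_zero_δ, s.map_zero_δ, hy, hy])

/-- In positive degrees, a family of elements all of whose faces are zero bounds a simplex. -/
lemma exists_faces_succ (s : ElementwiseContraction A aug P) (hP : IsRegularProjective P)
    (n : ℕ) (y : Fin (n + 3) → (P ⟶ level A (n + 1)))
    (hy : ∀ i j, y i ≫ A.δ j = 0) : ∃ v : P ⟶ level A (n + 2), ∀ j, v ≫ A.δ j = y j :=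
  exists_of_horn A hP (n + 1) (fun j => s.map (n + 1) (y j)) y (fun j => s.map_δ_zero _ _)
    (fun i j _ => by rw [s.map_succ_δ, s.map_succ_δ, hy, hy])

end ElementwiseContraction

lemma moore_d (A : SimplicialObject C) (n : ℕ) :
    ((moore C).obj A).d (n + 1) n = Moore.d A n := Moore.complex_d A n

/-- An augmented simplicial object of projectives is a resolution if its elements with respect to
enough projectives are contractible. -/
def SimplicialResolution.ofContraction {X : C} (A : SimplicialObject C) (aug : level A 0 ⟶ X)
    (δ_aug : A.δ (0 : Fin 2) ≫ aug = A.δ (1 : Fin 2) ≫ aug)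
    (projective : ∀ n, IsRegularProjective (level A n)) (h_aug : IsRegularEpi aug)
    (h : ∀ T : C, ∃ (P : C) (p : P ⟶ T), IsRegularProjective P ∧ IsRegularEpi p ∧
      Nonempty (ElementwiseContraction A aug P)) : SimplicialResolution X where
  obj := A
  aug := aug
  δ_aug := δ_aug
  projective := projective
  regularEpi_aug := h_aug
  exact_zero := by
    suffices H : IsExactPair (Moore.d A 0) (Moore.ι A 0 ≫ aug) by
      rw [moore_d]
      exact H
    have hw : Moore.d A 0 ≫ Moore.ι A 0 ≫ aug = 0 := by
      rw [← Category.assoc, Moore.d_ι, Category.assoc]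
      refine (congrArg (Moore.ι A 1 ≫ ·) δ_aug.symm).trans ?_
      change Moore.ι A 1 ≫ A.δ (0 : Fin 2) ≫ aug = 0
      rw [← Category.assoc, show Moore.ι A 1 ≫ A.δ (0 : Fin 2) = 0 from Moore.ι_δ A 0 0, zero_comp]
    obtain ⟨P, p, hP, hp, ⟨s⟩⟩ := h (kernel (Moore.ι A 0 ≫ aug))
    refine isExactPair_of_lift hw p hp ?_
    let z : P ⟶ level A 0 := p ≫ kernel.ι _ ≫ Moore.ι A 0
    have hz : z ≫ aug = 0 := by simp [z]
    -- The cycle `z` is bounded by a simplex whose other faces are zero.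
    obtain ⟨v, hv⟩ := s.exists_faces_zero hP ![0, z] (by
      intro i; fin_cases i
      · exact zero_comp
      · exact hz)
    refine ⟨Moore.lift A v fun l => by rw [Subsingleton.elim (α := Fin 1) l 0]; exact hv 0, ?_⟩
    rw [← cancel_mono (Moore.ι A 0), Category.assoc, Moore.d_ι, ← Category.assoc, Moore.lift_ι,
      Category.assoc]
    exact hv 1
  exact_succ n := by
    suffices H : IsExactPair (Moore.d A (n + 1)) (Moore.d A n) by
      rw [moore_d, moore_d]
      exact H
    obtain ⟨P, p, hP, hp, ⟨s⟩⟩ := h (kernel (Moore.d A n))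
    refine isExactPair_of_lift (Moore.d_d A n) p hp ?_
    let z : P ⟶ level A (n + 1) := p ≫ kernel.ι _ ≫ Moore.ι A (n + 1)
    have hz (i : Fin (n + 2)) : z ≫ A.δ i = 0 := by
      refine Fin.lastCases ?_ (fun l => ?_) i
      · simp only [z, Category.assoc]
        rw [← Moore.d_ι, kernel.condition_assoc, zero_comp, comp_zero]
      · simp only [z, Category.assoc]
        rw [Moore.ι_δ, comp_zero, comp_zero]
    obtain ⟨v, hv⟩ := s.exists_faces_succ hP n (Fin.snoc (fun _ => 0) z) (by
      intro i j
      refine Fin.lastCases ?_ (fun l => ?_) i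
      · rw [Fin.snoc_last]; exact hz j
      · rw [Fin.snoc_castSucc]; exact zero_comp)
    refine ⟨Moore.lift A v fun l => by rw [hv, Fin.snoc_castSucc], ?_⟩
    rw [← cancel_mono (Moore.ι A (n + 1)), Category.assoc, Moore.d_ι, ← Category.assoc,
      Moore.lift_ι, Category.assoc, hv, Fin.snoc_last]

end Contraction

/-! ### Faces of the comonad resolution -/

section BarrBeckFaces

variable {C : Type u₁} [Category.{v₁} C] (G : Comonad C)

open BarrBeck

lemma barrBeckObject_δ_zero (X : C) (n : ℕ) :
    ((barrBeckObject G).obj X).δ (0 : Fin (n + 2)) = counit G X (n + 1) := by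
  refine (act_skip G X (SimplexCategory.δ (0 : Fin (n + 2))).toOrderHom OrderHom.id
    (fun i => rfl)).trans ?_
  rw [act_id]
  exact Category.comp_id _

lemma barrBeckObject_δ_succ (X : C) (n : ℕ) (i : Fin (n + 2)) :
    ((barrBeckObject G).obj X).δ i.succ =
      app (m := n + 2) (n := n + 1) (((barrBeckObject G).obj X).δ i) := by
  refine (act_hit G X (SimplexCategory.δ i.succ).toOrderHom rfl).trans ?_
  rw [act_skip G X _ (SimplexCategory.δ i).toOrderHom (fun j => Fin.succ_succAbove_succ i j),
    app_comp, ← Category.assoc, comult_app_counit]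
  exact Category.id_comp _

lemma barrBeckObject_δ_one (X : C) :
    ((barrBeckObject G).obj X).δ (1 : Fin 2) = app (m := 1) (n := 0) (counit G X 0) := by
  refine (act_hit G X (SimplexCategory.δ (1 : Fin 2)).toOrderHom rfl).trans ?_
  rw [act_skip G X _ (empty 1) (fun j => j.elim0), app_comp, ← Category.assoc, comult_app_counit]
  refine (Category.id_comp _).trans (congrArg app ?_)
  rw [act, act]
  exact Category.comp_id _

end BarrBeckFaces

/-! ### Regular epimorphisms and free algebras in varieties -/

namespace Variety

variable {V : Variety.{w}}

lemma mono_of_injective {A B : V.Alg} (f : A ⟶ B) (hf : Function.Injective (Hom.toFun f)) :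
    Mono f :=
  ⟨fun _ _ e => Hom.ext (funext fun x => hf (congrFun (congrArg Hom.toFun e) x))⟩

lemma isIso_of_bijective {A B : V.Alg} (f : A ⟶ B) (hf : Function.Bijective (Hom.toFun f)) :
    IsIso f := by
  let e := Equiv.ofBijective _ hf
  let g : B ⟶ A := Hom.mk (A := B) (B := A) e.symm fun o b => by
    rw [Equiv.symm_apply_eq]
    refine Eq.trans ?_ (Hom.map_op f o _).symm
    exact congrArg (B.op o) (funext fun k => (e.apply_symm_apply (b k)).symm)
  exact ⟨g, Hom.ext (funext e.symm_apply_apply), Hom.ext (funext e.apply_symm_apply)⟩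

/-- The image of a homomorphism, a subalgebra of the codomain. -/
def image {A B : V.Alg} (f : A ⟶ B) : V.Alg where
  carrier := Set.range (Hom.toFun f)
  op o b := ⟨B.op o fun k => (b k).1, A.op o fun k => (b k).2.choose, by
    rw [Hom.map_op]
    exact congrArg (B.op o) (funext fun k => (b k).2.choose_spec)⟩
  sat p hp v := Subtype.ext (by
    rw [map_eval _ B.op Subtype.val (fun _ _ => rfl), map_eval _ B.op Subtype.val (fun _ _ => rfl)]
    exact B.sat p hp _)

/-- The inclusion of the image. -/
def imageι {A B : V.Alg} (f : A ⟶ B) : image f ⟶ B :=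
  Hom.mk (A := image f) (B := B) Subtype.val fun _ _ => rfl

/-- The corestriction of a homomorphism to its image. -/
def toImage {A B : V.Alg} (f : A ⟶ B) : A ⟶ image f :=
  Hom.mk (A := A) (B := image f) (fun a => ⟨Hom.toFun f a, a, rfl⟩) fun o a =>
    Subtype.ext (Hom.map_op f o a)

lemma surjective_of_strongEpi {A B : V.Alg} (f : A ⟶ B) [StrongEpi f] :
    Function.Surjective (Hom.toFun f) := by
  have := mono_of_injective (imageι f) Subtype.val_injective
  have : StrongEpi (toImage f ≫ imageι f) := ‹StrongEpi f›
  have := strongEpi_of_strongEpi (toImage f) (imageι f)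
  have := isIso_of_mono_of_strongEpi (imageι f)
  intro b
  obtain ⟨a, ha⟩ := (Hom.toFun (inv (imageι f)) b).2
  refine ⟨a, ha.trans ?_⟩
  exact congrFun (congrArg Hom.toFun (IsIso.inv_hom_id (imageι f))) b

instance : V.forget.ReflectsIsomorphisms where
  reflects f _ := isIso_of_bijective f ((isIso_iff_bijective (V.forget.map f)).1 inferInstance)

instance : V.forget.Faithful where
  map_injective h := Hom.ext (funext fun x => congr($h x))

end Variety

section FreeResolution

variable {C : Type u₁} [Category.{v₁} C] {V : Variety.{w}}

lemma surjective_map_of_isRegularEpi (e : C ≌ V.Alg) {X Y : C} (p : X ⟶ Y) (hp : IsRegularEpi p) :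
    Function.Surjective ((e.functor ⋙ V.forget).map p) := by
  have : StrongEpi p := inferInstance
  exact Variety.surjective_of_strongEpi (e.functor.map p)

lemma isRegularEpi_of_surjective_map [Regular C] (e : C ≌ V.Alg) {X Y : C} (p : X ⟶ Y)
    (hp : Function.Surjective ((e.functor ⋙ V.forget).map p)) : IsRegularEpi p := by
  have : Epi ((e.functor ⋙ V.forget).map p) := (epi_iff_surjective _).2 hp
  have : Epi p := (e.functor ⋙ V.forget).epi_of_epi_map this
  have : ExtremalEpi p := ⟨fun {Z} g i hgi hi => by
    have hinj : Function.Injective ((e.functor ⋙ V.forget).map i) :=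
      (mono_iff_injective _).1 inferInstance
    have hsurj : Function.Surjective ((e.functor ⋙ V.forget).map i) := fun y => by
      obtain ⟨x, rfl⟩ := hp y
      exact ⟨(e.functor ⋙ V.forget).map g x, by rw [← hgi, Functor.map_comp]; rfl⟩
    have : IsIso ((e.functor ⋙ V.forget).map i) := (isIso_iff_bijective _).2 ⟨hinj, hsurj⟩
    exact isIso_of_reflects_iso i (e.functor ⋙ V.forget)⟩
  infer_instance

variable {e : C ≌ V.Alg} {U : Type w ⥤ C}

lemma isRegularProjective_free (adj : U ⊣ e.functor ⋙ V.forget) (T : Type w) :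
    IsRegularProjective (U.obj T) := by
  intro X Y p f hp
  have hs := surjective_map_of_isRegularEpi e p hp
  let g : T ⟶ (e.functor ⋙ V.forget).obj X := ↾(fun t => (hs (adj.homEquiv T Y f t)).choose)
  have hg : g ≫ (e.functor ⋙ V.forget).map p = adj.homEquiv T Y f := by
    ext t
    exact (hs (adj.homEquiv T Y f t)).choose_spec
  exact ⟨(adj.homEquiv T X).symm g, by
    rw [← Adjunction.homEquiv_naturality_right_symm, hg, Equiv.symm_apply_apply]⟩

variable (adj : U ⊣ e.functor ⋙ V.forget)

lemma isRegularEpi_counit [Regular C] (X : C) : IsRegularEpi (adj.counit.app X) :=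
  isRegularEpi_of_surjective_map e _ fun y =>
    ⟨adj.unit.app _ y, congr($(adj.right_triangle_components X) y)⟩

open BarrBeck

/-- The extra degeneracy of the comonad resolution, given by the unit of the adjunction. -/
def extraDegeneracy (X : C) {T : Type w} (n : ℕ) (x : U.obj T ⟶ pow adj.toComonad X n) :
    U.obj T ⟶ pow adj.toComonad X (n + 1) :=
  U.map (adj.homEquiv T _ x)

lemma extraDegeneracy_counit (X : C) {T : Type w} (n : ℕ)
    (x : U.obj T ⟶ pow adj.toComonad X n) :
    extraDegeneracy adj X n x ≫ counit adj.toComonad X n = x := by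
  refine ((adj.homEquiv_counit (g := adj.homEquiv T _ x)).symm).trans ?_
  exact Equiv.symm_apply_apply _ _

lemma extraDegeneracy_app (X : C) {T : Type w} {m n : ℕ} (x : U.obj T ⟶ pow adj.toComonad X m)
    (f : pow adj.toComonad X m ⟶ pow adj.toComonad X n) :
    extraDegeneracy adj X m x ≫ app f = extraDegeneracy adj X n (x ≫ f) :=
  (U.map_comp _ _).symm.trans (congrArg U.map (adj.homEquiv_naturality_right x f).symm)

variable [HasZeroMorphisms C] [IsHomological C]

/-- The comonad resolution of an object of a variety. -/
def barrBeckResolution (X : C) : SimplicialResolution X :=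
  .ofContraction ((barrBeckObject adj.toComonad).obj X) (counit adj.toComonad X 0)
    (by
      rw [barrBeckObject_δ_zero, barrBeckObject_δ_one]
      exact (app_counit _ _).symm)
    (fun _ => isRegularProjective_free adj _)
    (isRegularEpi_counit adj X)
    (fun T => ⟨_, adj.counit.app T, isRegularProjective_free adj _, isRegularEpi_counit adj T,
      ⟨{base := extraDegeneracy adj X 0
        map n := extraDegeneracy adj X (n + 1)
        base_aug := extraDegeneracy_counit adj X 0
        map_δ_zero n x := by
          rw [barrBeckObject_δ_zero]
          exact extraDegeneracy_counit adj X (n + 1) x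
        map_zero_δ x := by
          rw [barrBeckObject_δ_one]
          exact extraDegeneracy_app adj X x _
        map_succ_δ n x i := by
          rw [barrBeckObject_δ_succ]
          exact extraDegeneracy_app adj X x _ }⟩⟩)

end FreeResolution

/-! ### Derived functors -/

section DerivedFunctors

variable {C : Type u₁} [Category.{v₁} C] [HasZeroMorphisms C] [IsHomological C]
  [HasBinaryCoproducts C] {E : Type u₂} [Category.{v₂} E] [HasZeroMorphisms E] [IsHomological E]
  [HasBinaryCoproducts E] [HasCokernels E] (F : C ⥤ E) [IsProtoadditive F]

/-- The left derived functors with respect to a choice of resolutions. -/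
def leftDerivedFunctor (hP : ConditionP C) (R : ∀ X : C, ChainResolution X) (n : ℕ) :
    LeftDerivedFunctor F R n where
  functor :=
    { obj X := (homologyFunctor E n).obj ((mapComplex F).obj (R X).complex)
      map {X Y} x := (homologyFunctor E n).map
        ((mapComplex F).map ((R X).exists_lifting (R Y) x).choose)
      map_id X := by
        rw [homology_map_eq F hP (R X).projective (R X) _ (𝟙 _)
          (by rw [((R X).exists_lifting (R X) (𝟙 X)).choose_spec]; simp),
          CategoryTheory.Functor.map_id, CategoryTheory.Functor.map_id]
      map_comp {X Y Z} x y := by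
        rw [← Functor.map_comp, ← Functor.map_comp]
        refine homology_map_eq F hP (R X).projective (R Z) _ _ ?_ n
        have h₁ := ((R X).exists_lifting (R Y) x).choose_spec
        have h₂ := ((R Y).exists_lifting (R Z) y).choose_spec
        rw [((R X).exists_lifting (R Z) (x ≫ y)).choose_spec, HomologicalComplex.comp_f,
          Category.assoc, h₂, reassoc_of% h₁] }
  objIso X := Iso.refl _
  map_objIso {X Y} x φ hφ := by
    refine (Category.comp_id _).trans (Eq.trans ?_ (Category.id_comp _).symm)
    exact homology_map_eq F hP (R X).projective (R Y) _ _
      (((R X).exists_lifting (R Y) x).choose_spec.trans hφ.symm) n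

/-- The comonad resolution computes the left derived functors. -/
lemma nonempty_iso_simplicialDerived (hP : ConditionP C) {V : Variety.{w}} {e : C ≌ V.Alg}
    {U : Type w ⥤ C} (adj : U ⊣ e.functor ⋙ V.forget) {R : ∀ X : C, ChainResolution X} {n : ℕ}
    (L : LeftDerivedFunctor F R n) :
    Nonempty (L.functor ≅ simplicialDerived adj.toComonad F n) := by
  -- The functorial Moore complex of the comonad resolution is a chain resolution `T X`, and
  -- the morphisms `ξ x` between these lift `x`.
  let B := barrBeckObject adj.toComonad
  let T (X : C) : ChainResolution X := (barrBeckResolution adj X).toChainResolution hP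
  let ξ {X Y : C} (x : X ⟶ Y) : (T X).complex ⟶ (T Y).complex := (moore C).map (B.map x)
  have hξ {X Y : C} (x : X ⟶ Y) : (ξ x).f 0 ≫ (T Y).aug = (T X).aug ≫ x := by
    have h₁ : (T X).aug = BarrBeck.counit adj.toComonad X 0 := Category.id_comp _
    have h₂ : (T Y).aug = BarrBeck.counit adj.toComonad Y 0 := Category.id_comp _
    rw [h₁, h₂]
    exact BarrBeck.app_counit (m := 0) (n := 0) adj.toComonad x
  choose φ hφ using fun X : C => (R X).exists_lifting (T X) (𝟙 X)
  choose i hi using fun X : C => exists_homologyIso F hP (R X) (T X) n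
  have hφi (X : C) : (homologyFunctor E n).map ((mapComplex F).map (φ X)) = (i X).hom :=
    hi X (φ X) ((hφ X).trans (Category.comp_id _))
  let j (X : C) : (homologyFunctor E n).obj ((mapComplex F).obj (T X).complex) ≅
      (simplicialDerived adj.toComonad F n).obj X :=
    (homologyFunctor E n).mapIso (mooreComparisonIso F (B.obj X))
  have hj {X Y : C} (x : X ⟶ Y) : (homologyFunctor E n).map ((mapComplex F).map (ξ x)) ≫ (j Y).hom =
      (j X).hom ≫ (simplicialDerived adj.toComonad F n).map x :=
    ((homologyFunctor E n).map_comp _ _).symm.trans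
      ((congrArg (homologyFunctor E n).map (mooreComparison_naturality F (B.map x))).trans
        ((homologyFunctor E n).map_comp _ _))
  refine ⟨NatIso.ofComponents (fun X => L.objIso X ≪≫ i X ≪≫ j X) fun {X Y} x => ?_⟩
  obtain ⟨ψ, hψ⟩ := (R X).exists_lifting (R Y) x
  have key : (homologyFunctor E n).map ((mapComplex F).map ψ) ≫ (i Y).hom =
      (i X).hom ≫ (homologyFunctor E n).map ((mapComplex F).map (ξ x)) := by
    rw [← hφi, ← hφi, ← Functor.map_comp, ← Functor.map_comp, ← Functor.map_comp,
      ← Functor.map_comp]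
    refine homology_map_eq F hP (R X).projective (T Y) _ _ ?_ n
    rw [HomologicalComplex.comp_f, HomologicalComplex.comp_f, Category.assoc, Category.assoc, hφ,
      hξ, Category.comp_id, hψ, reassoc_of% hφ X]
  simp only [Iso.trans_hom, Category.assoc]
  rw [reassoc_of% L.map_objIso x ψ hψ, reassoc_of% key, hj]

end DerivedFunctors

end NonAdditive

end

open NonAdditive

theorem theorem10p5 {C : Type u₁} [Category.{v₁} C] [HasZeroMorphisms C] [IsHomological C]
    [HasBinaryCoproducts C] (hproj : EnoughRegularProjectives C) (hP : ConditionP C)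
    {E : Type u₂} [Category.{v₂} E] [HasZeroMorphisms E] [IsSemiAbelian E]
    (F : C ⥤ E) [IsProtoadditive F] [PreservesColimitsOfShape (Discrete WalkingPair) F]
    (hF : PreservesProper F) :
    (∀ (X : C) (S : SimplicialResolution X) (R : ChainResolution X),
      -- the three complexes are proper, so that their homology is defined
      IsProperComplex ((moore E).obj ((mapSimplicial F).obj S.obj)) ∧
      IsProperComplex ((mapComplex F).obj ((moore C).obj S.obj)) ∧
      IsProperComplex ((mapComplex F).obj R.complex) ∧
      -- `H_n(F(N(S))) = H_n(N(F(S)))`, via the canonical comparison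
      (∀ n : ℕ, IsIso ((homologyFunctor E n).map (mooreComparison F S.obj))) ∧
      -- `H_n(F(N(S))) = H_n(F(R))`, via an arbitrary lifting of the identity of `X`
      (∃ φ : (moore C).obj S.obj ⟶ R.complex, φ.f 0 ≫ R.aug = Moore.ι S.obj 0 ≫ S.aug) ∧
      (∀ n : ℕ, ∃ i : (homologyFunctor E n).obj ((mapComplex F).obj ((moore C).obj S.obj)) ≅
          (homologyFunctor E n).obj ((mapComplex F).obj R.complex),
        ∀ φ : (moore C).obj S.obj ⟶ R.complex, φ.f 0 ≫ R.aug = Moore.ι S.obj 0 ≫ S.aug →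
          (homologyFunctor E n).map ((mapComplex F).map φ) = i.hom)) ∧
    -- the case where `C` is (equivalent to) a variety of algebras
    (∀ (V : Variety.{w}) (e : C ≌ V.Alg) (U : Type w ⥤ C) (adj : U ⊣ e.functor ⋙ V.forget)
      (R : ∀ X : C, ChainResolution X) (n : ℕ),
      Nonempty (LeftDerivedFunctor F R n) ∧
      ∀ L : LeftDerivedFunctor F R n,
        Nonempty (L.functor ≅ simplicialDerived adj.toComonad F n)) := by
  refine ⟨fun X S R => ?_, fun V e U adj R n => ⟨⟨leftDerivedFunctor F hP R n⟩, fun L =>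
    nonempty_iso_simplicialDerived F hP adj L⟩⟩
  let T : ChainResolution X := S.toChainResolution hP
  have hT : IsProperComplex ((mapComplex F).obj T.complex) := fun n => hF _ (T.isProperComplex n)
  obtain ⟨φ, hφ⟩ := T.exists_lifting R (𝟙 X)
  refine ⟨hT.of_iso (mooreComparisonIso F S.obj), hT, fun n => hF _ (R.isProperComplex n),
    fun n => ((homologyFunctor E n).mapIso (mooreComparisonIso F S.obj)).isIso_hom,
    ⟨φ, hφ.trans (Category.comp_id _)⟩, fun n =>
      exists_homologyIso F hP T R n⟩
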